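/- Let $(\Omega,\mathcal F,\mathbb P)$ be a probability space and let $L_0$ be the space of classes (modulo $\mathbb P$-a.s. equality) of finite real measurable functions, with the topology $\tau_{L_0}$ of convergence in probability and the a.s. pointwise order. Let $\Phi:\mathbb R\to\mathbb R$ be a (finite coercive) Young function, i.e. an even convex function with $\Phi(0)=0$ and $\lim_{x\to\infty}\Phi(x)/x=\infty$, and suppose that $\Phi\in\Delta_2$, i.e. $\limsup_{x\to\infty}\Phi(2x)/\Phi(x)<\infty$. Let $\Phi^*(y)=\sup_{x\in\mathbb R}(xy-\Phi(x))$, which is again a Young function, and for a Young function $\Psi$ let $L_\Psi=\{\xi\in L_0:\ \mathbb E[\Psi(\lambda\xi)]<\infty\text{ for some }\lambda>0\}$ be the Orlicz space. The spaces $L_{\Phi^*}$ and $L_\Phi$ are paired by $\langle\xi,\eta\rangle=\mathbb E[\eta\xi]$; let $\sigma(L_{\Phi^*},L_\Phi)$ be the weak topology of this pairing and $\tau(L_{\Phi^*},L_\Phi)$ its Mackey topology, i.e. the topology of uniform convergence on the absolutely convex $\sigma(L_\Phi,L_{\Phi^*})$-compact subsets of $L_\Phi$. For $0\le\zeta\in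 L_{\Phi^*}$ let $[-\zeta,\zeta]=\{\xi\in L_{\Phi^*}:-\zeta\le\xi\le\zeta\}$. **Theorem 4.4.** Let $f:L_{\Phi^*}\to(-\infty,\infty]$ be a proper convex function (convex and not identically $\infty$), and let $f^*(\eta)=\sup_{\xi\in L_{\Phi^*}}(\mathbb E[\eta\xi]-f(\xi))$ for $\eta\in L_\Phi$. The following are equivalent. 1. $f$ is $\sigma(L_{\Phi^*},L_\Phi)$-lower semicontinuous (lsc), or equivalently $f(\xi)=\sup_{\eta\in L_\Phi}(\mathbb E[\eta\xi]-f^*(\eta))$ for all $\xi\in L_{\Phi^*}$. 2. $f$ is sequentially $\tau(L_{\Phi^*},L_\Phi)$-lsc: $f(\xi)\le\liminf_n f(\xi_n)$ whenever $\xi_n\to\xi$ in $\tau(L_{\Phi^*},L_\Phi)$. 3. $f$ is $\tau_{L_0}$-lsc on every order interval $[-\zeta,\zeta]$ with $0\le\zeta\in L_{\Phi^*}$, or equivalently $f$ is order lsc: $f(\xi)\le\liminf_n f(\xi_n)$ whenever $\xi,\xi_n\in L_{\Phi^*}$, $\xi_n\to\xi$ a.s. and there is $\zeta\in L_{\Phi^*}$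 with $-\zeta\le\xi_n\le\zeta$ for all $n$. -/

import Mathlib

open MeasureTheory Filter Topology Set
open scoped ENNReal

/-- A (finite coercive) Young function: an even convex function `Φ : ℝ → ℝ` with `Φ 0 = 0` and
`Φ x / x → ∞` as `x → ∞`. -/
structure YoungFunction where
  toFun : ℝ → ℝ
  even' : ∀ x, toFun (-x) = toFun x
  convex' : ConvexOn ℝ univ toFun
  zero' : toFun 0 = 0
  coercive' : Tendsto (fun x => toFun x / x) atTop atTop

namespace YoungFunction

instance : CoeFun YoungFunction (fun _ => ℝ → ℝ) := ⟨YoungFunction.toFun⟩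

variable (Φ : YoungFunction)

theorem nonneg (x : ℝ) : 0 ≤ Φ x := by
  have h := Φ.convex'.2 (mem_univ x) (mem_univ (-x)) (show (0 : ℝ) ≤ 1 / 2 by norm_num)
    (show (0 : ℝ) ≤ 1 / 2 by norm_num) (by norm_num)
  simp only [smul_eq_mul, Φ.even'] at h
  rw [show (1 / 2 : ℝ) * x + 1 / 2 * -x = 0 by ring, Φ.zero'] at h
  linarith

theorem mul_le_mul {t x : ℝ} (h0 : 0 ≤ t) (h1 : t ≤ 1) : Φ (t * x) ≤ t * Φ x := by
  have h := Φ.convex'.2 (mem_univ x) (mem_univ 0) h0 (sub_nonneg.2 h1) (by ring)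
  simpa [Φ.zero'] using h

theorem abs_eq (x : ℝ) : Φ |x| = Φ x := by
  rcases abs_choice x with h | h <;> simp [h, Φ.even']

theorem mono_abs {x y : ℝ} (h : |x| ≤ |y|) : Φ x ≤ Φ y := by
  rcases eq_or_ne y 0 with rfl | hy
  · have : x = 0 := by simpa using h
    rw [this]
  · have hy' : 0 < |y| := abs_pos.2 hy
    rw [← Φ.abs_eq x, ← Φ.abs_eq y]
    have h1 : |x| / |y| ≤ 1 := (div_le_one hy').2 h
    have := Φ.mul_le_mul (t := |x| / |y|) (x := |y|) (by positivity) h1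
    rw [div_mul_cancel₀ _ hy'.ne'] at this
    exact this.trans (mul_le_of_le_one_left (Φ.nonneg _) h1)

theorem continuous : Continuous Φ := by
  rw [← continuousOn_univ]
  exact Φ.convex'.continuousOn isOpen_univ

theorem bddAbove_conj (y : ℝ) : BddAbove (range fun x : ℝ => x * y - Φ x) := by
  obtain ⟨R, hR⟩ := eventually_atTop.1 (Φ.coercive'.eventually_ge_atTop |y|)
  refine ⟨(|R| + 1) * |y|, ?_⟩
  rintro _ ⟨x, rfl⟩
  have hxy : x * y ≤ |x| * |y| := by rw [← abs_mul]; exact le_abs_self _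
  rcases le_total |x| (|R| + 1) with h | h
  · have := mul_le_mul_of_nonneg_right h (abs_nonneg y)
    have := Φ.nonneg x
    simp only
    linarith
  · have hx : 0 < |x| := by have := abs_nonneg R; linarith
    have h1 := hR |x| (by have := le_abs_self R; linarith)
    rw [le_div_iff₀ hx, Φ.abs_eq] at h1
    have : 0 ≤ (|R| + 1) * |y| := by positivity
    simp only
    linarith

theorem le_iSup_conj (x y : ℝ) : x * y - Φ x ≤ ⨆ x : ℝ, (x * y - Φ x) :=
  le_ciSup (f := fun x : ℝ => x * y - Φ x) (Φ.bddAbove_conj y) x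

/-- The conjugate `Φ*(y) = sup_x (x y - Φ x)`, which is again a Young function. The supremum is
that of a nonempty set of reals which is bounded above, by `bddAbove_conj`. -/
noncomputable def conj : YoungFunction where
  toFun y := ⨆ x : ℝ, (x * y - Φ x)
  even' y := by
    rw [← (Equiv.neg ℝ).iSup_comp]
    simp [Φ.even']
  convex' := by
    refine ⟨convex_univ, fun y _ z _ a b ha hb hab => ciSup_le fun x => ?_⟩
    have h1 := mul_le_mul_of_nonneg_left (Φ.le_iSup_conj x y) ha
    have h2 := mul_le_mul_of_nonneg_left (Φ.le_iSup_conj x z) hb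
    have h3 : Φ x = a * Φ x + b * Φ x := by rw [← add_mul, hab, one_mul]
    simp only [smul_eq_mul]
    nlinarith
  zero' := by
    apply le_antisymm
    · exact ciSup_le fun x => by simpa using Φ.nonneg x
    · simpa [Φ.zero'] using Φ.le_iSup_conj 0 0
  coercive' := by
    refine tendsto_atTop.2 fun c => ?_
    filter_upwards [eventually_ge_atTop (max 1 (Φ (c + 1)))] with y hy
    have hy1 : 1 ≤ y := (le_max_left _ _).trans hy
    have hy2 : Φ (c + 1) ≤ y := (le_max_right _ _).trans hy
    rw [le_div_iff₀ (by linarith)]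
    have := Φ.le_iSup_conj (c + 1) y
    linarith

theorem young (x y : ℝ) : x * y ≤ Φ x + Φ.conj y := by
  have : x * y - Φ x ≤ Φ.conj y := Φ.le_iSup_conj x y
  linarith

theorem young_abs (x y : ℝ) : |x * y| ≤ Φ x + Φ.conj y := by
  have := Φ.young |x| |y|
  rwa [Φ.abs_eq, Φ.conj.abs_eq, ← abs_mul] at this

/-- The `Δ₂`-condition `limsup_{x → ∞} Φ(2x) / Φ(x) < ∞`. -/
def Delta2 : Prop := limsup (fun x : ℝ => ((Φ (2 * x) / Φ x : ℝ) : EReal)) atTop < ⊤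

end YoungFunction

section Orlicz

variable {Ω : Type*} [MeasurableSpace Ω] (P : Measure Ω)

theorem YoungFunction.aemeasurable_comp (Φ : YoungFunction) (c : ℝ) (ξ : Ω →ₘ[P] ℝ) :
    AEMeasurable (fun ω => ENNReal.ofReal (Φ (c * ξ ω))) P :=
  (Φ.continuous.measurable.comp_aemeasurable (ξ.aemeasurable.const_mul c)).ennreal_ofReal

/-- The Orlicz space `L_Φ`: the classes modulo a.s. equality of finite measurable functions `ξ`
such that `E[Φ(c ξ)] < ∞` for some `c > 0`. -/
noncomputable def orliczSpace (Φ : YoungFunction) : Submodule ℝ (Ω →ₘ[P] ℝ) where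
  carrier := {ξ | ∃ c : ℝ, 0 < c ∧ ∫⁻ ω, ENNReal.ofReal (Φ (c * ξ ω)) ∂P < ∞}
  zero_mem' := by
    refine ⟨1, one_pos, ?_⟩
    have : ∫⁻ ω, ENNReal.ofReal (Φ (1 * (0 : Ω →ₘ[P] ℝ) ω)) ∂P = 0 := by
      rw [lintegral_congr_ae (g := fun _ => 0), lintegral_zero]
      filter_upwards [AEEqFun.coeFn_zero (α := Ω) (β := ℝ) (μ := P)] with ω hω
      simp [hω, Φ.zero']
    rw [this]
    exact ENNReal.zero_lt_top
  add_mem' := by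
    rintro ξ ζ ⟨a, ha, hξ⟩ ⟨b, hb, hζ⟩
    have hc : 0 < min a b := lt_min ha hb
    refine ⟨min a b / 2, by positivity, ?_⟩
    refine lt_of_le_of_lt (lintegral_mono_ae (g := fun ω =>
      ENNReal.ofReal (Φ (a * ξ ω)) + ENNReal.ofReal (Φ (b * ζ ω))) ?_) ?_
    · filter_upwards [AEEqFun.coeFn_add ξ ζ] with ω hω
      rw [← ENNReal.ofReal_add (Φ.nonneg _) (Φ.nonneg _), hω, Pi.add_apply]
      refine ENNReal.ofReal_le_ofReal ?_
      have h := Φ.convex'.2 (mem_univ (min a b * ξ ω)) (mem_univ (min a b * ζ ω))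
        (show (0 : ℝ) ≤ 1 / 2 by norm_num) (show (0 : ℝ) ≤ 1 / 2 by norm_num) (by norm_num)
      have h1 : Φ (min a b * ξ ω) ≤ Φ (a * ξ ω) := Φ.mono_abs (by
        rw [abs_mul, abs_mul, abs_of_pos hc, abs_of_pos ha]
        exact mul_le_mul_of_nonneg_right (min_le_left _ _) (abs_nonneg _))
      have h2 : Φ (min a b * ζ ω) ≤ Φ (b * ζ ω) := Φ.mono_abs (by
        rw [abs_mul, abs_mul, abs_of_pos hc, abs_of_pos hb]
        exact mul_le_mul_of_nonneg_right (min_le_right _ _) (abs_nonneg _))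
      have h3 := Φ.nonneg (a * ξ ω)
      have h4 := Φ.nonneg (b * ζ ω)
      simp only [smul_eq_mul] at h
      rw [show min a b / 2 * (ξ ω + ζ ω) =
        1 / 2 * (min a b * ξ ω) + 1 / 2 * (min a b * ζ ω) by ring]
      linarith
    · rw [lintegral_add_left' (Φ.aemeasurable_comp P a ξ)]
      exact ENNReal.add_lt_top.2 ⟨hξ, hζ⟩
  smul_mem' := by
    rintro r ξ ⟨a, ha, hξ⟩
    refine ⟨a / (|r| + 1), by positivity, lt_of_le_of_lt (lintegral_mono_ae ?_) hξ⟩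
    filter_upwards [AEEqFun.coeFn_smul r ξ] with ω hω
    refine ENNReal.ofReal_le_ofReal (Φ.mono_abs ?_)
    rw [hω, Pi.smul_apply, smul_eq_mul, abs_mul, abs_mul, abs_mul, abs_div, abs_of_pos ha,
      abs_of_pos (by positivity : 0 < |r| + 1), ← mul_assoc]
    refine mul_le_mul_of_nonneg_right ?_ (abs_nonneg _)
    rw [div_mul_eq_mul_div, div_le_iff₀ (by positivity)]
    nlinarith [abs_nonneg r]

theorem integrable_mul_of_mem_orliczSpace (Φ : YoungFunction) {η ξ : Ω →ₘ[P] ℝ}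
    (hη : η ∈ orliczSpace P Φ) (hξ : ξ ∈ orliczSpace P Φ.conj) :
    Integrable (fun ω => η ω * ξ ω) P := by
  obtain ⟨a, ha, hη⟩ : ∃ c : ℝ, 0 < c ∧ ∫⁻ ω, ENNReal.ofReal (Φ (c * η ω)) ∂P < ∞ := hη
  obtain ⟨b, hb, hξ⟩ : ∃ c : ℝ, 0 < c ∧ ∫⁻ ω, ENNReal.ofReal (Φ.conj (c * ξ ω)) ∂P < ∞ := hξ
  have hm : Integrable (fun ω => (a * η ω) * (b * ξ ω)) P := by
    refine ⟨((η.aestronglyMeasurable.const_mul a).mul (ξ.aestronglyMeasurable.const_mul b)), ?_⟩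
    rw [hasFiniteIntegral_iff_enorm]
    refine lt_of_le_of_lt (lintegral_mono (g := fun ω =>
      ENNReal.ofReal (Φ (a * η ω)) + ENNReal.ofReal (Φ.conj (b * ξ ω))) fun ω => ?_) ?_
    · simp only
      rw [← ENNReal.ofReal_add (Φ.nonneg _) (Φ.conj.nonneg _), Real.enorm_eq_ofReal_abs]
      exact ENNReal.ofReal_le_ofReal (Φ.young_abs _ _)
    · rw [lintegral_add_left' (Φ.aemeasurable_comp P a η)]
      exact ENNReal.add_lt_top.2 ⟨hη, hξ⟩
  refine (hm.const_mul (a * b)⁻¹).congr (Eventually.of_forall fun ω => ?_)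
  field_simp

/-- The pairing `⟨ξ, η⟩ = E[η ξ]` of `ξ ∈ L_{Φ*}` and `η ∈ L_Φ`. -/
noncomputable def orliczPairing (Φ : YoungFunction) :
    orliczSpace P Φ.conj →ₗ[ℝ] orliczSpace P Φ →ₗ[ℝ] ℝ :=
  LinearMap.mk₂ ℝ
    (fun ξ η => ∫ ω, (η : Ω →ₘ[P] ℝ) ω * (ξ : Ω →ₘ[P] ℝ) ω ∂P)
    (fun ξ ζ η => by
      rw [← integral_add (integrable_mul_of_mem_orliczSpace P Φ η.2 ξ.2)
        (integrable_mul_of_mem_orliczSpace P Φ η.2 ζ.2)]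
      refine integral_congr_ae ?_
      filter_upwards [AEEqFun.coeFn_add (ξ : Ω →ₘ[P] ℝ) (ζ : Ω →ₘ[P] ℝ)] with ω hω
      simp only [Submodule.coe_add, hω, Pi.add_apply]
      ring)
    (fun c ξ η => by
      rw [smul_eq_mul, ← integral_const_mul]
      refine integral_congr_ae ?_
      filter_upwards [AEEqFun.coeFn_smul c (ξ : Ω →ₘ[P] ℝ)] with ω hω
      simp only [Submodule.coe_smul, hω, Pi.smul_apply, smul_eq_mul]
      ring)
    (fun ξ η ρ => by
      rw [← integral_add (integrable_mul_of_mem_orliczSpace P Φ η.2 ξ.2)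
        (integrable_mul_of_mem_orliczSpace P Φ ρ.2 ξ.2)]
      refine integral_congr_ae ?_
      filter_upwards [AEEqFun.coeFn_add (η : Ω →ₘ[P] ℝ) (ρ : Ω →ₘ[P] ℝ)] with ω hω
      simp only [Submodule.coe_add, hω, Pi.add_apply]
      ring)
    (fun c ξ η => by
      rw [smul_eq_mul, ← integral_const_mul]
      refine integral_congr_ae ?_
      filter_upwards [AEEqFun.coeFn_smul c (η : Ω →ₘ[P] ℝ)] with ω hω
      simp only [Submodule.coe_smul, hω, Pi.smul_apply, smul_eq_mul]
      ring)

theorem integrable_min_abs_sub [IsFiniteMeasure P] (ξ ζ : Ω →ₘ[P] ℝ) :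
    Integrable (fun ω => min |ξ ω - ζ ω| 1) P := by
  refine Integrable.of_bound (C := 1) ?_ (Eventually.of_forall fun ω => ?_)
  · exact ((continuous_abs.comp_aestronglyMeasurable
      (ξ.aestronglyMeasurable.sub ζ.aestronglyMeasurable)).inf aestronglyMeasurable_const)
  · rw [Real.norm_eq_abs, abs_of_nonneg (le_min (abs_nonneg _) zero_le_one)]
    exact min_le_right _ _

/-- The translation invariant metric `d(ξ, ζ) = E[|ξ - ζ| ∧ 1]` on `L₀`, which metrises
convergence in probability. (Mathlib puts no topology on `Ω →ₘ[P] ℝ`.) -/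
@[reducible]
noncomputable def l0PseudoMetric [IsFiniteMeasure P] : PseudoMetricSpace (Ω →ₘ[P] ℝ) where
  dist ξ ζ := ∫ ω, min |ξ ω - ζ ω| 1 ∂P
  dist_self ξ := by simp
  dist_comm ξ ζ := by simp only [abs_sub_comm]
  dist_triangle ξ ζ ρ := by
    rw [← integral_add (integrable_min_abs_sub P ξ ζ) (integrable_min_abs_sub P ζ ρ)]
    refine integral_mono (integrable_min_abs_sub P ξ ρ)
      ((integrable_min_abs_sub P ξ ζ).add (integrable_min_abs_sub P ζ ρ)) fun ω => ?_
    have h := abs_sub_le (ξ ω) (ζ ω) (ρ ω)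
    have h1 := abs_nonneg (ξ ω - ζ ω)
    have h2 := abs_nonneg (ζ ω - ρ ω)
    simp only
    rcases le_total |ξ ω - ζ ω| 1 with h3 | h3 <;> rcases le_total |ζ ω - ρ ω| 1 with h4 | h4 <;>
      simp only [h3, h4, min_eq_left, min_eq_right] <;>
      first
      | exact (min_le_left _ _).trans h
      | exact (min_le_right _ _).trans (by linarith)

/-- The topology `τ_{L₀}` of convergence in probability, restricted to a linear subspace of
`L₀`. -/
@[reducible]
noncomputable def l0Topology [IsFiniteMeasure P] (L : Submodule ℝ (Ω →ₘ[P] ℝ)) :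
    TopologicalSpace L :=
  TopologicalSpace.induced (fun ξ => (ξ : Ω →ₘ[P] ℝ))
    (l0PseudoMetric P).toUniformSpace.toTopologicalSpace

end Orlicz

section DualPair

variable {E F : Type*} [AddCommGroup E] [Module ℝ E] [AddCommGroup F] [Module ℝ F]

/-- The weak topology `σ(E, F)` of a pairing `B` of `E` and `F`. -/
@[reducible]
def weakTopology (B : E →ₗ[ℝ] F →ₗ[ℝ] ℝ) : TopologicalSpace E :=
  inferInstanceAs (TopologicalSpace (WeakBilin B))

/-- The Mackey topology `τ(E, F)` of a pairing `B` of `E` and `F`: the topology on `E` of uniform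
convergence on the absolutely convex `σ(F, E)`-compact subsets of `F`. -/
@[reducible]
def mackeyTopology (B : E →ₗ[ℝ] F →ₗ[ℝ] ℝ) : TopologicalSpace E :=
  TopologicalSpace.induced
    (fun x => UniformOnFun.ofFun
      {A : Set F | Convex ℝ A ∧ Balanced ℝ A ∧ @IsCompact F (weakTopology B.flip) A}
      (fun y => B x y))
    inferInstance

end DualPair

/-- A function `f : E → (-∞, ∞]` that is not identically `∞` and is convex. As `f` does not take
the value `-∞`, the right-hand side of the convexity inequality never has the form `∞ - ∞`. -/
structure IsProperConvex {E : Type*} [AddCommGroup E] [Module ℝ E] (f : E → EReal) : Prop where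
  ne_bot : ∀ x, f x ≠ ⊥
  exists_ne_top : ∃ x, f x ≠ ⊤
  convex : ∀ (x y : E) (a b : ℝ), 0 < a → 0 < b → a + b = 1 →
    f (a • x + b • y) ≤ (a : EReal) * f x + (b : EReal) * f y

/-- The conjugate `f*(y) = sup_x (⟨x, y⟩ - f x)` with respect to a pairing. -/
noncomputable def conjugateFun {E F : Type*} [AddCommGroup E] [Module ℝ E] [AddCommGroup F]
    [Module ℝ F] (B : E →ₗ[ℝ] F →ₗ[ℝ] ℝ) (f : E → EReal) (y : F) : EReal :=
  ⨆ x : E, (((B x y : ℝ) : EReal) - f x)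

/-!
Write `Ψ = Φ*`. The implications from weak lower semicontinuity to the other properties rest on two
facts. The Fenchel–Moreau theorem for a pairing (`IsProperConvex.eq_biconjugate`) gives the dual
representation. A dominated almost surely convergent sequence in `L_Ψ` converges in the Mackey
topology (`tendsto_mackeyTopology`), so that sequential Mackey lower semicontinuity implies order
lower semicontinuity. The second fact replaces the Dunford–Pettis theorem by a gliding hump: on a
weakly compact subset of `L_Φ` the terms of an absolutely dominated series are uniformly small.

The substance is the way back: a convex order closed set `C` in `L_Ψ` is weakly closed
(`IsOrderClosed.isClosed_weakTopology`). The proof follows Krein–Šmulian and has three ingredients.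

* By the `Δ₂`-condition, `Ψ (y / N)` is much smaller than `Ψ y / N` for suitable large `N` and large
  `y`. Hence averages of many terms with disjoint supports have small modulars, and a norm bounded,
  almost surely convergent sequence in `L_Ψ` has forward averages that are dominated by a single
  element of `L_Ψ` (`YoungFunction.Delta2.exists_dominated_averages`). So the bounded parts of `C`
  are closed under almost sure convergence.
* A directed family of nonempty convex sets that are closed under almost sure convergence and
  bounded in `L₁` has a common element (`exists_forall_mem_of_convex_of_bounded`). This takes the
  place of weak compactness and needs no description of the dual space.
* As in the classical proof, finite sets of constraints with norms tending to zero keep all balls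
  away from `C`. Separation in the space of bounded families then produces a functional that is a
  summable combination of these constraints, and such a combination is an element of `L_Φ`
  (`IsOrderClosed.exists_separating`).

Lower semicontinuity for convergence in probability on order intervals is the same as order lower
semicontinuity, because a sequence that converges fast in probability converges almost surely.
-/

/-! ### Growth of Young functions and their conjugates -/

namespace YoungFunction

variable (Φ : YoungFunction)

/-- Sublevel sets of a Young function are bounded. -/
theorem exists_abs_le (C : ℝ) : ∃ R : ℝ, 0 < R ∧ ∀ x, Φ x ≤ C → |x| ≤ R := by
  obtain ⟨R, hR⟩ := eventually_atTop.1 (Φ.coercive'.eventually_ge_atTop 1)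
  refine ⟨max (max R 1) C, by positivity, fun x hx => ?_⟩
  by_contra! h
  have h1 : R ≤ |x| := ((le_max_left _ _).trans (le_max_left _ _)).trans h.le
  have h2 : 1 ≤ |x| := ((le_max_right _ _).trans (le_max_left _ _)).trans h.le
  have h3 := hR |x| h1
  rw [le_div_iff₀ (by linarith), Φ.abs_eq] at h3
  have := le_max_right (max R 1) C
  linarith

/-- The `Δ₂`-condition as an inequality valid on the whole line. -/
theorem Delta2.exists_bound {Φ : YoungFunction} (hΦ : Φ.Delta2) :
    ∃ N : ℕ, 2 ≤ N ∧ ∃ K : ℝ, 0 ≤ K ∧ ∀ x, Φ (2 * x) ≤ 2 * N * Φ x + K := by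
  obtain ⟨c, hc, hc'⟩ := EReal.lt_iff_exists_real_btwn.1 hΦ
  have h1 := eventually_lt_of_limsup_lt hc
  have h2 := Φ.coercive'.eventually_ge_atTop 1
  obtain ⟨R, hR⟩ := eventually_atTop.1 (h1.and (h2.and (eventually_ge_atTop 1)))
  obtain ⟨N, hN⟩ := exists_nat_ge (max c 2)
  have hN2 : (2 : ℝ) ≤ N := (le_max_right _ _).trans hN
  refine ⟨N, by exact_mod_cast hN2, Φ (2 * R), Φ.nonneg _, fun x => ?_⟩
  have hΦx := Φ.nonneg x
  rcases le_total |x| R with hx | hx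
  · have : Φ (2 * x) ≤ Φ (2 * R) := Φ.mono_abs (by
      rw [abs_mul, abs_mul]
      exact mul_le_mul_of_nonneg_left (hx.trans (le_abs_self _)) (abs_nonneg _))
    have : 0 ≤ 2 * N * Φ x := by positivity
    linarith
  · obtain ⟨h3, h4, h5⟩ := hR |x| hx
    have h3 : Φ (2 * |x|) / Φ |x| < c := by exact_mod_cast h3
    have hpos : 0 < Φ |x| := by
      have : 1 * |x| ≤ Φ |x| := (le_div_iff₀ (by linarith)).1 h4
      linarith
    rw [div_lt_iff₀ hpos] at h3
    have h6 : Φ (2 * |x|) = Φ (2 * x) := by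
      rw [← Φ.abs_eq (2 * x), abs_mul, abs_two]
    rw [h6, Φ.abs_eq] at h3
    have h7 : c * Φ x ≤ 2 * N * Φ x :=
      mul_le_mul_of_nonneg_right (by linarith [le_max_left c 2]) hΦx
    linarith [Φ.nonneg (2 * R)]

/-- The dual form of the `Δ₂`-condition: averaging `N ^ n` copies of a large value reduces the
conjugate by more than the factor `N ^ n`. -/
theorem Delta2.conj_div_pow_le {Φ : YoungFunction} (hΦ : Φ.Delta2) :
    ∃ N : ℕ, 2 ≤ N ∧ ∃ K : ℝ, 0 ≤ K ∧
      ∀ (n : ℕ) y, Φ.conj (y / (N : ℝ) ^ n) ≤ Φ.conj y / (2 * N) ^ n + K := by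
  obtain ⟨N, hN, K, hK, h⟩ := hΦ.exists_bound
  have hN' : (2 : ℝ) ≤ N := by exact_mod_cast hN
  have key : ∀ y, Φ.conj (y / N) ≤ (Φ.conj y + K) / (2 * N) := by
    intro y
    refine ciSup_le fun x => ?_
    rw [le_div_iff₀ (by positivity)]
    have h1 := Φ.young (2 * x) y
    have h2 : (x * (y / N) - Φ x) * (2 * N) = 2 * x * y - 2 * N * Φ x := by
      field_simp
    linarith [h x]
  refine ⟨N, hN, K, hK, fun n y => ?_⟩
  induction n with
  | zero => simpa using hK
  | succ n ih =>
    have h1 := key (y / (N : ℝ) ^ n)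
    rw [div_div, ← pow_succ] at h1
    refine h1.trans ?_
    rw [div_le_iff₀ (by positivity)]
    have h2 : (Φ.conj y / (2 * (N : ℝ)) ^ (n + 1) + K) * (2 * N)
        = Φ.conj y / (2 * (N : ℝ)) ^ n + K * (2 * N) := by
      rw [pow_succ]; field_simp
    rw [h2]
    nlinarith

end YoungFunction

/-! ### Domination and order closed sets in Orlicz spaces -/

section Orlicz

variable {Ω : Type*} [MeasurableSpace Ω] {P : Measure Ω} {Φ Ψ : YoungFunction}

theorem mem_orliczSpace_of_abs_le {ξ ζ : Ω →ₘ[P] ℝ} (hζ : ζ ∈ orliczSpace P Ψ)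
    (h : ∀ᵐ ω ∂P, |ξ ω| ≤ ζ ω) : ξ ∈ orliczSpace P Ψ := by
  obtain ⟨c, hc, hfin⟩ : ∃ c : ℝ, 0 < c ∧ ∫⁻ ω, ENNReal.ofReal (Ψ (c * ζ ω)) ∂P < ∞ := hζ
  refine ⟨c, hc, lt_of_le_of_lt (lintegral_mono_ae ?_) hfin⟩
  filter_upwards [h] with ω hω
  refine ENNReal.ofReal_le_ofReal (Ψ.mono_abs ?_)
  rw [abs_mul, abs_mul]
  exact mul_le_mul_of_nonneg_left (hω.trans (le_abs_self _)) (abs_nonneg _)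

theorem mem_orliczSpace_of_lintegral_lt_top {ξ : Ω →ₘ[P] ℝ}
    (h : ∫⁻ ω, ENNReal.ofReal (Ψ (ξ ω)) ∂P < ∞) : ξ ∈ orliczSpace P Ψ :=
  ⟨1, one_pos, by simpa using h⟩

theorem mem_orliczSpace_of_bounded [IsFiniteMeasure P] {ξ : Ω →ₘ[P] ℝ} {C : ℝ}
    (h : ∀ᵐ ω ∂P, |ξ ω| ≤ C) : ξ ∈ orliczSpace P Ψ := by
  refine mem_orliczSpace_of_lintegral_lt_top (lt_of_le_of_lt
    (lintegral_mono_ae (g := fun _ => ENNReal.ofReal (Ψ C)) ?_) ?_)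
  · filter_upwards [h] with ω hω
    exact ENNReal.ofReal_le_ofReal (Ψ.mono_abs (hω.trans (le_abs_self _)))
  · rw [lintegral_const]
    exact ENNReal.mul_lt_top ENNReal.ofReal_lt_top (measure_lt_top _ _)

theorem mem_Icc_neg_iff {ξ ζ : Ω →ₘ[P] ℝ} : ξ ∈ Icc (-ζ) ζ ↔ ∀ᵐ ω ∂P, |ξ ω| ≤ ζ ω := by
  rw [mem_Icc, ← AEEqFun.coeFn_le, ← AEEqFun.coeFn_le]
  constructor
  · rintro ⟨h1, h2⟩
    filter_upwards [h1, h2, AEEqFun.coeFn_neg ζ] with ω h1 h2 h3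
    rw [h3, Pi.neg_apply] at h1
    exact abs_le.2 ⟨h1, h2⟩
  · intro h
    constructor
    · filter_upwards [h, AEEqFun.coeFn_neg ζ] with ω h1 h3
      rw [h3, Pi.neg_apply]
      exact (abs_le.1 h1).1
    · filter_upwards [h] with ω h1
      exact (abs_le.1 h1).2

/-- A sequence with summable modulars is dominated by a single element of the Orlicz space. -/
theorem exists_dominating_of_tsum_ne_top {x : ℕ → Ω → ℝ} (hx : ∀ n, AEMeasurable (x n) P)
    (h : ∑' n, ∫⁻ ω, ENNReal.ofReal (Ψ (x n ω)) ∂P ≠ ∞) :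
    ∃ ζ ∈ orliczSpace P Ψ, ∀ᵐ ω ∂P, ∀ n, |x n ω| ≤ ζ ω := by
  have hm : ∀ n, AEMeasurable (fun ω => ENNReal.ofReal (Ψ (x n ω))) P := fun n =>
    (Ψ.continuous.measurable.comp_aemeasurable (hx n)).ennreal_ofReal
  rw [← lintegral_tsum hm] at h
  have hfin := ae_lt_top' (AEMeasurable.tsum hm) h
  have hsup : AEMeasurable (fun ω => ⨆ n, |x n ω|) P :=
    AEMeasurable.iSup fun n => continuous_abs.measurable.comp_aemeasurable (hx n)
  -- the values `x n ω` stay in a sublevel set of `Ψ`, which is bounded and closed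
  have key : ∀ᵐ ω ∂P, BddAbove (range fun n => |x n ω|) ∧
      ENNReal.ofReal (Ψ (⨆ n, |x n ω|)) ≤ ∑' n, ENNReal.ofReal (Ψ (x n ω)) := by
    filter_upwards [hfin] with ω hω
    have h1 : ∀ n, Ψ (x n ω) ≤ (∑' n, ENNReal.ofReal (Ψ (x n ω))).toReal := fun n =>
      (ENNReal.ofReal_le_iff_le_toReal hω.ne).1 (ENNReal.le_tsum n)
    obtain ⟨R, -, hR⟩ := Ψ.exists_abs_le (∑' n, ENNReal.ofReal (Ψ (x n ω))).toReal
    have hbdd : BddAbove (range fun n => |x n ω|) :=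
      ⟨R, by rintro _ ⟨n, rfl⟩; exact hR _ (h1 n)⟩
    refine ⟨hbdd, (ENNReal.ofReal_le_iff_le_toReal hω.ne).2 ?_⟩
    have hcl : IsClosed {t | Ψ t ≤ (∑' n, ENNReal.ofReal (Ψ (x n ω))).toReal} :=
      isClosed_le Ψ.continuous continuous_const
    have hmem := csSup_mem_closure (range_nonempty fun n => |x n ω|) hbdd
    refine closure_minimal ?_ hcl hmem
    rintro _ ⟨n, rfl⟩
    simpa [Ψ.abs_eq] using h1 n
  refine ⟨AEEqFun.mk _ hsup.aestronglyMeasurable, ?_, ?_⟩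
  · refine mem_orliczSpace_of_lintegral_lt_top (lt_of_le_of_lt (lintegral_mono_ae ?_)
      (lt_top_iff_ne_top.2 h))
    filter_upwards [key, AEEqFun.coeFn_mk _ hsup.aestronglyMeasurable] with ω h1 h2
    rw [h2]
    exact h1.2
  · filter_upwards [key, AEEqFun.coeFn_mk _ hsup.aestronglyMeasurable] with ω h1 h2 n
    rw [h2]
    exact le_ciSup h1.1 n

theorem orliczPairing_apply (ξ : orliczSpace P Φ.conj) (η : orliczSpace P Φ) :
    orliczPairing P Φ ξ η = ∫ ω, (η : Ω →ₘ[P] ℝ) ω * (ξ : Ω →ₘ[P] ℝ) ω ∂P := rfl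

theorem abs_orliczPairing_le (ξ : orliczSpace P Φ.conj) (η : orliczSpace P Φ) :
    |orliczPairing P Φ ξ η| ≤ ∫ ω, |(η : Ω →ₘ[P] ℝ) ω * (ξ : Ω →ₘ[P] ℝ) ω| ∂P :=
  abs_integral_le_integral_abs

/-- The pairing is continuous along dominated almost surely convergent sequences. -/
theorem tendsto_orliczPairing {ξ : orliczSpace P Φ.conj} {u : ℕ → orliczSpace P Φ.conj}
    {ζ : Ω →ₘ[P] ℝ} (hζ : ζ ∈ orliczSpace P Φ.conj)
    (hb : ∀ n, ∀ᵐ ω ∂P, |(u n : Ω →ₘ[P] ℝ) ω| ≤ ζ ω)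
    (hlim : ∀ᵐ ω ∂P, Tendsto (fun n => (u n : Ω →ₘ[P] ℝ) ω) atTop (𝓝 ((ξ : Ω →ₘ[P] ℝ) ω)))
    (η : orliczSpace P Φ) :
    Tendsto (fun n => orliczPairing P Φ (u n) η) atTop (𝓝 (orliczPairing P Φ ξ η)) := by
  refine tendsto_integral_of_dominated_convergence
    (fun ω => |(η : Ω →ₘ[P] ℝ) ω * ζ ω|) ?_
    (integrable_mul_of_mem_orliczSpace P Φ η.2 hζ).abs ?_ ?_
  · exact fun n => (integrable_mul_of_mem_orliczSpace P Φ η.2 (u n).2).aestronglyMeasurable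
  · intro n
    filter_upwards [hb n] with ω hω
    rw [Real.norm_eq_abs, abs_mul, abs_mul]
    exact mul_le_mul_of_nonneg_left (hω.trans (le_abs_self _)) (abs_nonneg _)
  · filter_upwards [hlim] with ω hω
    exact hω.const_mul _

/-- A set of elements of an Orlicz space is order closed if it contains the almost sure limits in
the space of its sequences that are dominated by an element of the space. -/
def IsOrderClosed (C : Set (orliczSpace P Ψ)) : Prop :=
  ∀ (ξ : orliczSpace P Ψ) (u : ℕ → orliczSpace P Ψ), (∀ n, u n ∈ C) →
    (∀ᵐ ω ∂P, Tendsto (fun n => (u n : Ω →ₘ[P] ℝ) ω) atTop (𝓝 ((ξ : Ω →ₘ[P] ℝ) ω))) →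
    (∃ ζ ∈ orliczSpace P Ψ, ∀ n, ∀ᵐ ω ∂P, |(u n : Ω →ₘ[P] ℝ) ω| ≤ ζ ω) → ξ ∈ C

theorem IsOrderClosed.inter {C D : Set (orliczSpace P Ψ)} (hC : IsOrderClosed C)
    (hD : IsOrderClosed D) : IsOrderClosed (C ∩ D) := fun ξ u hu h1 h2 =>
  ⟨hC ξ u (fun n => (hu n).1) h1 h2, hD ξ u (fun n => (hu n).2) h1 h2⟩

theorem isOrderClosed_iInter {ι : Sort*} {C : ι → Set (orliczSpace P Ψ)}
    (hC : ∀ i, IsOrderClosed (C i)) : IsOrderClosed (⋂ i, C i) := fun ξ u hu h1 h2 =>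
  mem_iInter.2 fun i => hC i ξ u (fun n => mem_iInter.1 (hu n) i) h1 h2

theorem isOrderClosed_abs_orliczPairing_le (η : orliczSpace P Φ) (r : ℝ) :
    IsOrderClosed {ξ | |orliczPairing P Φ ξ η| ≤ r} := by
  rintro ξ u hu h1 ⟨ζ, hζ, h2⟩
  exact le_of_tendsto (tendsto_orliczPairing hζ h2 h1 η).abs (Eventually.of_forall hu)

theorem convex_abs_orliczPairing_le (η : orliczSpace P Φ) (r : ℝ) :
    Convex ℝ {ξ | |orliczPairing P Φ ξ η| ≤ r} := by
  have : {ξ | |orliczPairing P Φ ξ η| ≤ r} = (orliczPairing P Φ).flip η ⁻¹' Icc (-r) r := by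
    ext ξ; simp [abs_le]
  rw [this]
  exact (convex_Icc _ _).linear_preimage _

end Orlicz

/-! ### Dominated averages of bounded sequences -/

/-- Extraction of a subsequence along which a condition on pairs of indices holds, where the
condition becomes stricter with the position `l` of the later index. -/
theorem exists_strictMono_forall_lt {p : ℕ → ℕ → ℕ → Prop} {q : ℕ → ℕ → Prop}
    (hp : ∀ i l, ∀ᶠ k in atTop, p i k l) (hq : ∀ l, ∀ᶠ k in atTop, q k l) :
    ∃ φ : ℕ → ℕ, StrictMono φ ∧ (∀ j l, j < l → p (φ j) (φ l) l) ∧ ∀ l, q (φ l) l := by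
  have h : ∀ m l, ∃ k, m < k ∧ (∀ i ∈ Finset.range (m + 1), p i k l) ∧ q k l := fun m l =>
    ((eventually_gt_atTop m).and
      (((Finset.eventually_all _).2 fun i _ => hp i l).and (hq l))).exists
  choose g hg1 hg2 hg3 using h
  let φ : ℕ → ℕ := fun n => Nat.rec (g 0 0) (fun l m => g m (l + 1)) n
  have hφ : ∀ l, φ (l + 1) = g (φ l) (l + 1) := fun l => rfl
  have hmono : StrictMono φ := strictMono_nat_of_lt_succ fun l => by rw [hφ]; exact hg1 _ _
  refine ⟨φ, hmono, ?_, ?_⟩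
  · rintro j (_ | l) hjl
    · exact absurd hjl (Nat.not_lt_zero j)
    · rw [hφ]
      exact hg2 _ _ _ (Finset.mem_range.2
        (Nat.lt_succ_of_le (hmono.monotone (Nat.le_of_lt_succ hjl))))
  · rintro (_ | l)
    · exact hg3 _ _
    · rw [hφ]; exact hg3 _ _

theorem tsum_inv_two_pow : ∑' n : ℕ, (2⁻¹ : ℝ≥0∞) ^ n = 2 := by
  rw [ENNReal.tsum_geometric, ENNReal.one_sub_inv_two, inv_inv]

/-- Averages over the windows `[n, n + M n)` of a convergent sequence converge to its limit. -/
theorem tendsto_window_average {x : ℕ → ℝ} {a : ℝ} (hx : Tendsto x atTop (𝓝 a)) {M : ℕ → ℕ}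
    (hM : ∀ n, 0 < M n) :
    Tendsto (fun n => (M n : ℝ)⁻¹ * ∑ j ∈ Finset.Ico n (n + M n), x j) atTop (𝓝 a) := by
  rw [Metric.tendsto_atTop] at hx ⊢
  intro ε hε
  obtain ⟨n₀, hn₀⟩ := hx (ε / 2) (by positivity)
  refine ⟨n₀, fun n hn => ?_⟩
  have hM' : (0 : ℝ) < M n := by exact_mod_cast hM n
  have h1 : (M n : ℝ)⁻¹ * ∑ j ∈ Finset.Ico n (n + M n), x j - a
      = (M n : ℝ)⁻¹ * ∑ j ∈ Finset.Ico n (n + M n), (x j - a) := by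
    rw [Finset.sum_sub_distrib]
    simp
    field_simp
  rw [Real.dist_eq, h1, abs_mul, abs_of_pos (inv_pos.2 hM'), inv_mul_lt_iff₀ hM']
  calc |∑ j ∈ Finset.Ico n (n + M n), (x j - a)|
      ≤ ∑ j ∈ Finset.Ico n (n + M n), |x j - a| := Finset.abs_sum_le_sum_abs _ _
    _ ≤ ∑ j ∈ Finset.Ico n (n + M n), ε / 2 := Finset.sum_le_sum fun j hj =>
        (hn₀ j (hn.trans (Finset.mem_Ico.1 hj).1)).le
    _ = M n * (ε / 2) := by simp
    _ < M n * ε := by nlinarith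

namespace YoungFunction

variable (Ψ : YoungFunction)

/-- A Young function is subadditive on sums with at most one nonzero term. -/
theorem apply_sum_le_of_disjoint {ι : Type*} {s : Finset ι} {a : ι → ℝ}
    (h : ∀ i ∈ s, ∀ j ∈ s, i ≠ j → a i = 0 ∨ a j = 0) :
    Ψ (∑ i ∈ s, a i) ≤ ∑ i ∈ s, Ψ (a i) := by
  by_cases hz : ∀ i ∈ s, a i = 0
  · rw [Finset.sum_eq_zero hz, Ψ.zero']
    exact Finset.sum_nonneg fun i _ => Ψ.nonneg _
  · push Not at hz
    obtain ⟨i, hi, hai⟩ := hz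
    rw [Finset.sum_eq_single_of_mem i hi fun j hj hji => (h i hi j hj hji.symm).resolve_left hai]
    exact Finset.single_le_sum (f := fun i => Ψ (a i)) (fun j _ => Ψ.nonneg _) hi

end YoungFunction

section Averages

variable {Ω : Type*} [MeasurableSpace Ω] {P : Measure Ω} {Φ : YoungFunction}

/-- Integrals over the sets where an almost surely null sequence is large tend to zero. -/
theorem tendsto_setLIntegral_abs_gt {y : ℕ → Ω → ℝ} (hy : ∀ k, Measurable (y k))
    (h0 : ∀ᵐ ω ∂P, Tendsto (fun k => y k ω) atTop (𝓝 0)) {h : Ω → ℝ≥0∞} (hh : AEMeasurable h P)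
    (hfin : ∫⁻ ω, h ω ∂P ≠ ∞)
    {t : ℝ} (ht : 0 < t) :
    Tendsto (fun k => ∫⁻ ω in {ω | t < |y k ω|}, h ω ∂P) atTop (𝓝 0) := by
  have hm : ∀ k, MeasurableSet {ω | t < |y k ω|} := fun k =>
    measurableSet_lt measurable_const (hy k).abs
  simp_rw [← lintegral_indicator (hm _)]
  rw [← lintegral_zero (μ := P)]
  refine tendsto_lintegral_of_dominated_convergence' h (fun k => hh.indicator (hm k))
    (fun k => Eventually.of_forall fun ω => indicator_le_self _ _ _) hfin ?_
  filter_upwards [h0] with ω hω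
  refine tendsto_const_nhds.congr' ?_
  filter_upwards [(hω.abs).eventually_lt_const (by simpa using ht : |(0 : ℝ)| < t)] with k hk
  rw [indicator_of_notMem]
  simpa using hk.le

/-- A sequence which is bounded in the modular of `Φ*` and tends to zero almost surely has a
subsequence whose averages over suitable windows are dominated in the Orlicz space. The values of
absolute value at most one are harmless. The subsequence is chosen so that the large values that
overlap with those of later terms have summable modulars. What remains has disjoint supports, and
by the `Δ₂`-condition the modular of an average of `M` such terms is much smaller than the average
of their modulars. -/
theorem YoungFunction.Delta2.exists_dominated_averages_of_tendsto_zero [IsProbabilityMeasure P]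
    (hΦ : Φ.Delta2) {y : ℕ → Ω → ℝ} (hy : ∀ k, Measurable (y k))
    (hb : ∀ k, ∫⁻ ω, ENNReal.ofReal (Φ.conj (y k ω)) ∂P ≤ 1)
    (h0 : ∀ᵐ ω ∂P, Tendsto (fun k => y k ω) atTop (𝓝 0)) :
    ∃ φ : ℕ → ℕ, StrictMono φ ∧ ∃ M : ℕ → ℕ, (∀ n, 0 < M n) ∧ ∃ ζ ∈ orliczSpace P Φ.conj,
      ∀ᵐ ω ∂P, ∀ n, |(M n : ℝ)⁻¹ * ∑ j ∈ Finset.Ico n (n + M n), y (φ j) ω| ≤ ζ ω := by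
  set Ψ := Φ.conj with hΨ
  obtain ⟨N, hN, K, hK, hNK⟩ := hΦ.conj_div_pow_le
  have hN' : (0 : ℝ) < N := by exact_mod_cast (by omega : 0 < N)
  have hΨm : ∀ {z : Ω → ℝ}, Measurable z → Measurable fun ω => ENNReal.ofReal (Ψ (z ω)) :=
    fun hz => (Ψ.continuous.measurable.comp hz).ennreal_ofReal
  have hpow : ∀ l : ℕ, (0 : ℝ≥0∞) < 2⁻¹ ^ l * 2⁻¹ ^ l := fun l =>
    ENNReal.mul_pos (pow_ne_zero _ (by simp)) (pow_ne_zero _ (by simp))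
  obtain ⟨φ, hφ, hφ1, hφ2⟩ := exists_strictMono_forall_lt
    (p := fun i k l => ∫⁻ ω in {ω | 1 < |y k ω|}, ENNReal.ofReal (Ψ (y i ω)) ∂P
      ≤ 2⁻¹ ^ l * 2⁻¹ ^ l)
    (q := fun k l => ∫⁻ ω in {ω | 1 < |y k ω|}, 1 ∂P ≤ 2⁻¹ ^ l * 2⁻¹ ^ l)
    (fun i l => (tendsto_setLIntegral_abs_gt hy h0 (hΨm (hy i)).aemeasurable
      (ne_top_of_le_ne_top ENNReal.one_ne_top (hb i)) one_pos).eventually_le_const (hpow l))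
    (fun l => (tendsto_setLIntegral_abs_gt hy h0 (h := fun _ => 1) aemeasurable_const
      (by simp) one_pos).eventually_le_const (hpow l))
  -- `A j` is where the `j`-th term is large, `B j` is where some later term is large
  set A : ℕ → Set Ω := fun j => {ω | 1 < |y (φ j) ω|} with hA
  have hAm : ∀ j, MeasurableSet (A j) := fun j => measurableSet_lt measurable_const (hy _).abs
  set B : ℕ → Set Ω := fun j => ⋃ m, A (j + 1 + m) with hB
  have hBm : ∀ j, MeasurableSet (B j) := fun j => MeasurableSet.iUnion fun m => hAm _
  set r : ℕ → Ω → ℝ := fun j => (B j).indicator (y (φ j)) with hr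
  set e : ℕ → Ω → ℝ := fun j => (A j \ B j).indicator (y (φ j)) with he
  have hrm : ∀ j, Measurable (r j) := fun j => (hy _).indicator (hBm j)
  have hem : ∀ j, Measurable (e j) := fun j => (hy _).indicator ((hAm j).diff (hBm j))
  have hdecomp : ∀ j ω, |y (φ j) ω| ≤ 1 + |r j ω| + |e j ω| := by
    intro j ω
    simp only [hr, he]
    by_cases h1 : ω ∈ B j
    · rw [indicator_of_mem h1]
      linarith [abs_nonneg ((A j \ B j).indicator (y (φ j)) ω)]
    · by_cases h2 : ω ∈ A j
      · rw [indicator_of_mem (show ω ∈ A j \ B j from ⟨h2, h1⟩)]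
        linarith [abs_nonneg ((B j).indicator (y (φ j)) ω)]
      · have : |y (φ j) ω| ≤ 1 := by simpa [hA] using h2
        linarith [abs_nonneg ((A j \ B j).indicator (y (φ j)) ω),
          abs_nonneg ((B j).indicator (y (φ j)) ω)]
  have hrsum : ∀ j, ∫⁻ ω, ENNReal.ofReal (Ψ (r j ω)) ∂P ≤ 2⁻¹ ^ j * 2 := by
    intro j
    have h1 : ∀ ω, ENNReal.ofReal (Ψ (r j ω))
        = (B j).indicator (fun ω => ENNReal.ofReal (Ψ (y (φ j) ω))) ω := by
      intro ω
      simp only [hr]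
      by_cases h : ω ∈ B j <;> simp [h, Ψ.zero']
    simp_rw [h1]
    rw [lintegral_indicator (hBm j)]
    refine (lintegral_iUnion_le _ _).trans ?_
    rw [show (2⁻¹ : ℝ≥0∞) ^ j * 2 = ∑' m, 2⁻¹ ^ j * 2⁻¹ ^ m by
      rw [ENNReal.tsum_mul_left, tsum_inv_two_pow]]
    refine ENNReal.tsum_le_tsum fun m => (hφ1 j (j + 1 + m) (by omega)).trans ?_
    refine mul_le_mul' ?_ ?_ <;>
      exact pow_le_pow_right_of_le_one' (ENNReal.inv_le_one.2 one_le_two) (by omega)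
  have hrtop : ∑' j, ∫⁻ ω, ENNReal.ofReal (Ψ (r j ω)) ∂P ≠ ∞ := by
    refine ne_top_of_le_ne_top ?_ (ENNReal.tsum_le_tsum hrsum)
    rw [ENNReal.tsum_mul_right, tsum_inv_two_pow]
    exact ENNReal.mul_ne_top (by simp) (by simp)
  obtain ⟨ρ, hρ, hρr⟩ := exists_dominating_of_tsum_ne_top (fun j => (hrm j).aemeasurable) hrtop
  -- the window average of the disjoint parts
  set d : ℕ → Ω → ℝ := fun n ω => ∑ j ∈ Finset.Ico n (n + N ^ n), |e j ω| / (N : ℝ) ^ n with hd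
  have hdm : ∀ n, Measurable (d n) := fun n =>
    Finset.measurable_fun_sum _ fun j _ => (hem j).abs.div_const _
  have hdisj : ∀ ω i j, i ≠ j → e i ω = 0 ∨ e j ω = 0 := by
    have key : ∀ ω i j, i < j → e i ω = 0 ∨ e j ω = 0 := by
      intro ω i j hij
      by_cases h : ω ∈ A j
      · left
        simp only [he]
        refine indicator_of_notMem (fun h' => h'.2 ?_) _
        refine mem_iUnion.2 ⟨j - (i + 1), ?_⟩
        rwa [show i + 1 + (j - (i + 1)) = j by omega]
      · right
        exact indicator_of_notMem (fun h' => h h'.1) _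
    intro ω i j hij
    rcases lt_or_gt_of_ne hij with h | h
    · exact key ω i j h
    · exact (key ω j i h).symm
  have hepw : ∀ n j ω, ENNReal.ofReal (Ψ (|e j ω| / (N : ℝ) ^ n)) ≤
      ENNReal.ofReal (1 / (2 * N) ^ n) * ENNReal.ofReal (Ψ (y (φ j) ω)) +
        (A j).indicator (fun _ => ENNReal.ofReal K) ω := by
    intro n j ω
    by_cases h : ω ∈ A j \ B j
    · have h1 : e j ω = y (φ j) ω := indicator_of_mem h _
      rw [h1, indicator_of_mem h.1, ← ENNReal.ofReal_mul (by positivity),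
        ← ENNReal.ofReal_add (mul_nonneg (by positivity) (Ψ.nonneg _)) hK]
      refine ENNReal.ofReal_le_ofReal ((hNK n _).trans_eq ?_)
      rw [← hΨ, Ψ.abs_eq]
      ring
    · have h1 : e j ω = 0 := indicator_of_notMem h _
      simp [h1, Ψ.zero']
  have heint : ∀ n j, ∫⁻ ω, ENNReal.ofReal (Ψ (|e j ω| / (N : ℝ) ^ n)) ∂P ≤
      ENNReal.ofReal (1 / (2 * N) ^ n) + ENNReal.ofReal K * (2⁻¹ ^ j * 2⁻¹ ^ j) := by
    intro n j
    refine (lintegral_mono (hepw n j)).trans ?_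
    rw [lintegral_add_left ((hΨm (hy _)).const_mul _), lintegral_const_mul _ (hΨm (hy _)),
      lintegral_indicator_const (hAm j)]
    refine add_le_add ?_ (mul_le_mul' le_rfl ?_)
    · exact (mul_le_mul' le_rfl (hb _)).trans_eq (mul_one _)
    · simpa using hφ2 j
  have hdint : ∀ n, ∫⁻ ω, ENNReal.ofReal (Ψ (d n ω)) ∂P ≤
      2⁻¹ ^ n + ENNReal.ofReal K * (2⁻¹ ^ n * 2) := by
    intro n
    have h1 : ∀ ω, ENNReal.ofReal (Ψ (d n ω)) ≤
        ∑ j ∈ Finset.Ico n (n + N ^ n), ENNReal.ofReal (Ψ (|e j ω| / (N : ℝ) ^ n)) := by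
      intro ω
      rw [← ENNReal.ofReal_sum_of_nonneg fun j _ => Ψ.nonneg _]
      refine ENNReal.ofReal_le_ofReal (Ψ.apply_sum_le_of_disjoint fun i _ j _ hij => ?_)
      rcases hdisj ω i j hij with h | h <;> simp [h]
    refine (lintegral_mono h1).trans ?_
    rw [lintegral_finsetSum _ fun j _ => hΨm ((hem j).abs.div_const _)]
    refine (Finset.sum_le_sum fun j _ => heint n j).trans ?_
    rw [Finset.sum_add_distrib, ← Finset.mul_sum]
    refine add_le_add (le_of_eq ?_) (mul_le_mul' le_rfl ?_)
    · rw [Finset.sum_const, Nat.card_Ico, nsmul_eq_mul, Nat.add_sub_cancel_left,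
        ← ENNReal.ofReal_natCast, ← ENNReal.ofReal_mul (by positivity)]
      rw [show (2⁻¹ : ℝ≥0∞) = ENNReal.ofReal 2⁻¹ by
        rw [ENNReal.ofReal_inv_of_pos two_pos]; simp, ← ENNReal.ofReal_pow (by norm_num)]
      congr 1
      push_cast
      rw [mul_pow, inv_pow]
      field_simp
    · calc ∑ j ∈ Finset.Ico n (n + N ^ n), (2⁻¹ : ℝ≥0∞) ^ j * 2⁻¹ ^ j
          ≤ ∑ j ∈ Finset.Ico n (n + N ^ n), (2⁻¹ : ℝ≥0∞) ^ n * 2⁻¹ ^ j :=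
            Finset.sum_le_sum fun j hj => mul_le_mul'
              (pow_le_pow_right_of_le_one' (by simp) (Finset.mem_Ico.1 hj).1) le_rfl
        _ = 2⁻¹ ^ n * ∑ j ∈ Finset.Ico n (n + N ^ n), (2⁻¹ : ℝ≥0∞) ^ j := by
            rw [Finset.mul_sum]
        _ ≤ 2⁻¹ ^ n * 2 := mul_le_mul' le_rfl
            ((ENNReal.sum_le_tsum _).trans_eq tsum_inv_two_pow)
  have hdtop : ∑' n, ∫⁻ ω, ENNReal.ofReal (Ψ (d n ω)) ∂P ≠ ∞ := by
    refine ne_top_of_le_ne_top ?_ (ENNReal.tsum_le_tsum hdint)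
    rw [ENNReal.tsum_add, ENNReal.tsum_mul_left, ENNReal.tsum_mul_right, tsum_inv_two_pow]
    exact ENNReal.add_ne_top.2 ⟨by simp, ENNReal.mul_ne_top (by simp) (by norm_num)⟩
  obtain ⟨κ, hκ, hκd⟩ := exists_dominating_of_tsum_ne_top (fun j => (hdm j).aemeasurable) hdtop
  have hone : AEEqFun.const Ω (1 : ℝ) ∈ orliczSpace P Ψ := by
    refine mem_orliczSpace_of_bounded (C := 1) ?_
    filter_upwards [AEEqFun.coeFn_const Ω (1 : ℝ)] with ω h
    simp [h]
  refine ⟨φ, hφ, fun n => N ^ n, fun n => pow_pos (by omega) n,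
    AEEqFun.const Ω (1 : ℝ) + ρ + κ, Submodule.add_mem _ (Submodule.add_mem _ hone hρ) hκ, ?_⟩
  filter_upwards [hρr, hκd, AEEqFun.coeFn_const Ω (1 : ℝ),
    AEEqFun.coeFn_add (AEEqFun.const Ω (1 : ℝ)) ρ,
    AEEqFun.coeFn_add (AEEqFun.const Ω (1 : ℝ) + ρ) κ] with ω h1 h2 h3 h4 h5 n
  rw [h5, Pi.add_apply, h4, Pi.add_apply, h3]
  have hM : (0 : ℝ) < (N : ℝ) ^ n := by positivity
  push_cast
  rw [abs_mul, abs_of_pos (inv_pos.2 hM), inv_mul_le_iff₀ hM]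
  have h6 : (N : ℝ) ^ n * d n ω = ∑ j ∈ Finset.Ico n (n + N ^ n), |e j ω| := by
    simp only [hd]
    rw [← Finset.sum_div, mul_div_cancel₀ _ hM.ne']
  calc |∑ j ∈ Finset.Ico n (n + N ^ n), y (φ j) ω|
      ≤ ∑ j ∈ Finset.Ico n (n + N ^ n), |y (φ j) ω| := Finset.abs_sum_le_sum_abs _ _
    _ ≤ ∑ j ∈ Finset.Ico n (n + N ^ n), (1 + ρ ω + |e j ω|) := Finset.sum_le_sum fun j _ => by
        linarith [hdecomp j ω, h1 j]
    _ = (N : ℝ) ^ n * (1 + ρ ω) + (N : ℝ) ^ n * d n ω := by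
        rw [Finset.sum_add_distrib, h6]; simp [mul_add]
    _ ≤ (N : ℝ) ^ n * (1 + ρ ω + κ ω) := by
        rw [mul_add _ (1 + ρ ω)]
        have := mul_le_mul_of_nonneg_left ((le_abs_self _).trans (h2 n)) hM.le
        linarith

/-- An almost surely convergent sequence which is bounded in the modular of `Φ*` has a subsequence
whose averages over suitable windows are dominated in the Orlicz space. -/
theorem YoungFunction.Delta2.exists_dominated_averages [IsProbabilityMeasure P]
    (hΦ : Φ.Delta2) {x : ℕ → Ω →ₘ[P] ℝ} {ξ : Ω →ₘ[P] ℝ} {c : ℝ} (hc : 0 < c)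
    (hb : ∀ k, ∫⁻ ω, ENNReal.ofReal (Φ.conj (c * x k ω)) ∂P ≤ 1)
    (hlim : ∀ᵐ ω ∂P, Tendsto (fun k => x k ω) atTop (𝓝 (ξ ω))) :
    ξ ∈ orliczSpace P Φ.conj ∧ ∃ φ : ℕ → ℕ, StrictMono φ ∧ ∃ M : ℕ → ℕ, (∀ n, 0 < M n) ∧
      ∃ ζ ∈ orliczSpace P Φ.conj,
        ∀ᵐ ω ∂P, ∀ n, |(M n : ℝ)⁻¹ * ∑ j ∈ Finset.Ico n (n + M n), x (φ j) ω| ≤ ζ ω := by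
  set Ψ := Φ.conj with hΨ
  have hxm : ∀ η : Ω →ₘ[P] ℝ, Measurable η := fun η => η.stronglyMeasurable.measurable
  have hm : ∀ η : Ω →ₘ[P] ℝ, Measurable fun ω => ENNReal.ofReal (Ψ (c * η ω)) := fun η =>
    (Ψ.continuous.measurable.comp ((hxm η).const_mul c)).ennreal_ofReal
  have hξ : ∫⁻ ω, ENNReal.ofReal (Ψ (c * ξ ω)) ∂P ≤ 1 := by
    calc ∫⁻ ω, ENNReal.ofReal (Ψ (c * ξ ω)) ∂P
        ≤ ∫⁻ ω, liminf (fun k => ENNReal.ofReal (Ψ (c * x k ω))) atTop ∂P := by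
          refine lintegral_mono_ae ?_
          filter_upwards [hlim] with ω hω
          exact (((ENNReal.continuous_ofReal.comp Ψ.continuous).tendsto _).comp
            (hω.const_mul c)).liminf_eq.ge
      _ ≤ liminf (fun k => ∫⁻ ω, ENNReal.ofReal (Ψ (c * x k ω)) ∂P) atTop :=
          lintegral_liminf_le fun k => hm _
      _ ≤ liminf (fun _ : ℕ => (1 : ℝ≥0∞)) atTop := liminf_le_liminf (Eventually.of_forall hb)
      _ = 1 := liminf_const 1
  have hξmem : ξ ∈ orliczSpace P Ψ := ⟨c, hc, hξ.trans_lt ENNReal.one_lt_top⟩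
  refine ⟨hξmem, ?_⟩
  have hyb : ∀ k, ∫⁻ ω, ENNReal.ofReal (Ψ (c / 2 * (x k ω - ξ ω))) ∂P ≤ 1 := by
    intro k
    have h1 : ∀ ω, ENNReal.ofReal (Ψ (c / 2 * (x k ω - ξ ω))) ≤ ENNReal.ofReal (1 / 2) *
        (ENNReal.ofReal (Ψ (c * x k ω)) + ENNReal.ofReal (Ψ (c * ξ ω))) := by
      intro ω
      rw [← ENNReal.ofReal_add (Ψ.nonneg _) (Ψ.nonneg _), ← ENNReal.ofReal_mul (by norm_num)]
      refine ENNReal.ofReal_le_ofReal ?_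
      have h := Ψ.convex'.2 (mem_univ (c * x k ω)) (mem_univ (-(c * ξ ω)))
        (show (0 : ℝ) ≤ 1 / 2 by norm_num) (show (0 : ℝ) ≤ 1 / 2 by norm_num) (by norm_num)
      simp only [smul_eq_mul, Ψ.even'] at h
      rw [show c / 2 * (x k ω - ξ ω) = 1 / 2 * (c * x k ω) + 1 / 2 * -(c * ξ ω) by ring]
      linarith
    refine (lintegral_mono h1).trans ?_
    rw [lintegral_const_mul' _ _ ENNReal.ofReal_ne_top, lintegral_add_left (hm _)]
    refine (mul_le_mul' le_rfl (add_le_add (hb k) hξ)).trans_eq ?_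
    rw [one_add_one_eq_two, ← ENNReal.ofReal_ofNat 2, ← ENNReal.ofReal_mul (by norm_num)]
    norm_num
  have hy0 : ∀ᵐ ω ∂P, Tendsto (fun k => c / 2 * (x k ω - ξ ω)) atTop (𝓝 0) := by
    filter_upwards [hlim] with ω hω
    simpa using (hω.sub_const (ξ ω)).const_mul (c / 2)
  obtain ⟨φ, hφ, M, hM, ζ, hζ, hζ'⟩ := hΦ.exists_dominated_averages_of_tendsto_zero (P := P)
    (y := fun k ω => c / 2 * (x k ω - ξ ω)) (fun k => ((hxm _).sub (hxm _)).const_mul _) hyb hy0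
  obtain ⟨c', hc', hfin⟩ := hξmem
  have habs : AEEqFun.mk (fun ω => |ξ ω|) ((hxm ξ).abs.aestronglyMeasurable)
      ∈ orliczSpace P Ψ := by
    refine ⟨c', hc', lt_of_le_of_lt (lintegral_mono_ae ?_) hfin⟩
    filter_upwards [AEEqFun.coeFn_mk _ ((hxm ξ).abs.aestronglyMeasurable (μ := P))] with ω hω
    rw [hω]
    exact ENNReal.ofReal_le_ofReal (Ψ.mono_abs (by rw [abs_mul, abs_mul, abs_abs]))
  refine ⟨φ, hφ, M, hM, _ + (2 / c) • ζ, Submodule.add_mem _ habs (Submodule.smul_mem _ _ hζ), ?_⟩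
  filter_upwards [hζ', AEEqFun.coeFn_mk _ ((hxm ξ).abs.aestronglyMeasurable (μ := P)),
    AEEqFun.coeFn_add (AEEqFun.mk _ ((hxm ξ).abs.aestronglyMeasurable (μ := P))) ((2 / c) • ζ),
    AEEqFun.coeFn_smul (2 / c) ζ] with ω h1 h2 h3 h4 n
  rw [h3, Pi.add_apply, h2, h4, Pi.smul_apply, smul_eq_mul]
  have hM' : (0 : ℝ) < M n := by exact_mod_cast hM n
  have h5 : (M n : ℝ)⁻¹ * ∑ j ∈ Finset.Ico n (n + M n), x (φ j) ω = ξ ω + 2 / c *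
      ((M n : ℝ)⁻¹ * ∑ j ∈ Finset.Ico n (n + M n), c / 2 * (x (φ j) ω - ξ ω)) := by
    rw [← Finset.mul_sum, Finset.sum_sub_distrib]
    simp
    field_simp
    ring
  rw [h5]
  refine (abs_add_le _ _).trans (add_le_add le_rfl ?_)
  rw [abs_mul, abs_of_pos (by positivity : 0 < 2 / c)]
  exact mul_le_mul_of_nonneg_left (h1 n) (by positivity)

end Averages

/-! ### Convex compactness in `L₀` -/

/-- The increasing homeomorphism `x ↦ x / √(1 + x²)` from the real line onto `(-1, 1)`. -/
noncomputable def squash (x : ℝ) : ℝ := x / √(1 + x ^ 2)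

theorem one_le_sqrt_one_add_sq (x : ℝ) : 1 ≤ √(1 + x ^ 2) :=
  Real.one_le_sqrt.2 (by nlinarith [sq_nonneg x])

theorem continuous_squash : Continuous squash :=
  continuous_id.div (by fun_prop) fun x => (one_pos.trans_le (one_le_sqrt_one_add_sq x)).ne'

theorem squash_sq (x : ℝ) : squash x ^ 2 = x ^ 2 / (1 + x ^ 2) := by
  rw [squash, div_pow, Real.sq_sqrt (by positivity)]

theorem abs_squash_lt_one (x : ℝ) : |squash x| < 1 := by
  rw [← sq_lt_one_iff_abs_lt_one, squash_sq, div_lt_one (by positivity)]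
  linarith

theorem squash_div_sqrt (x : ℝ) : squash x / √(1 - squash x ^ 2) = x := by
  have h1 : 1 - squash x ^ 2 = (1 + x ^ 2)⁻¹ := by
    rw [squash_sq]; field_simp; ring
  have := one_le_sqrt_one_add_sq x
  rw [h1, Real.sqrt_inv, squash, div_inv_eq_mul, div_mul_cancel₀ _ (by positivity)]

theorem tendsto_of_tendsto_squash {x : ℕ → ℝ} {t : ℝ} (ht : |t| < 1)
    (h : Tendsto (fun k => squash (x k)) atTop (𝓝 t)) :
    Tendsto x atTop (𝓝 (t / √(1 - t ^ 2))) := by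
  have h1 : 0 < 1 - t ^ 2 := sub_pos.2 ((sq_lt_one_iff_abs_lt_one t).2 ht)
  have hc : ContinuousAt (fun t : ℝ => t / √(1 - t ^ 2)) t :=
    continuousAt_id.div (by fun_prop) (Real.sqrt_pos.2 h1).ne'
  refine (hc.tendsto.comp h).congr fun k => ?_
  exact squash_div_sqrt _

/-- A quantitative form of the strict convexity of `x ↦ √(1 + x²)`. It compares the vectors `(1, x)`
and `(1, y)` of the plane: half the sum of their lengths exceeds the length of their midpoint by a
multiple of the squared distance of their directions. -/
theorem sq_squash_sub_le (x y : ℝ) : (squash x - squash y) ^ 2 ≤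
    8 * ((√(1 + x ^ 2) + √(1 + y ^ 2)) / 2 - √(1 + ((x + y) / 2) ^ 2)) := by
  have ha := one_le_sqrt_one_add_sq x
  have hb := one_le_sqrt_one_add_sq y
  have hm := one_le_sqrt_one_add_sq ((x + y) / 2)
  have ha2 := Real.sq_sqrt (show 0 ≤ 1 + x ^ 2 by positivity)
  have hb2 := Real.sq_sqrt (show 0 ≤ 1 + y ^ 2 by positivity)
  have hm2 := Real.sq_sqrt (show 0 ≤ 1 + ((x + y) / 2) ^ 2 by positivity)
  unfold squash
  set a := √(1 + x ^ 2)
  set b := √(1 + y ^ 2)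
  set m := √(1 + ((x + y) / 2) ^ 2)
  have hab : 0 < a * b := by positivity
  have hD : 0 ≤ a * b - 1 - x * y := by
    have : |1 + x * y| ≤ |a * b| := by
      rw [← sq_le_sq, mul_pow, ha2, hb2]
      nlinarith [sq_nonneg (x - y)]
    rw [abs_of_pos hab] at this
    linarith [le_abs_self (1 + x * y)]
  have hD2 : 2 * (a * b - 1 - x * y) = (a + b - 2 * m) * (a + b + 2 * m) := by nlinarith
  have hgap : 0 ≤ a + b - 2 * m := by
    by_contra! h
    have : (a + b - 2 * m) * (a + b + 2 * m) < 0 := mul_neg_of_neg_of_pos h (by positivity)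
    linarith
  have h1 : (x / a - y / b) ^ 2 ≤ 2 * (a * b - 1 - x * y) / (a * b) := by
    have e : 2 * (a * b - 1 - x * y) / (a * b) - (x / a - y / b) ^ 2 = (1 / a - 1 / b) ^ 2 := by
      have hx : x ^ 2 = a ^ 2 - 1 := by linarith
      have hy : y ^ 2 = b ^ 2 - 1 := by linarith
      field_simp
      ring_nf
      rw [hx, hy]
      ring
    linarith [sq_nonneg (1 / a - 1 / b)]
  refine h1.trans ?_
  rw [div_le_iff₀ hab, hD2]
  have h2 : a + b ≤ 2 * (a * b) := by nlinarith
  calc (a + b - 2 * m) * (a + b + 2 * m) ≤ (a + b - 2 * m) * (2 * (2 * (a * b))) :=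
        mul_le_mul_of_nonneg_left (by linarith) hgap
    _ = 8 * ((a + b) / 2 - m) * (a * b) := by ring

section ConvexCompactness

variable {Ω : Type*} [MeasurableSpace Ω] {P : Measure Ω}

theorem ae_summable_abs_of_lintegral_sq_le [IsProbabilityMeasure P] {Δ : ℕ → Ω → ℝ}
    (hm : ∀ k, Measurable (Δ k)) {C : ℝ}
    (h : ∀ k, ∫⁻ ω, ENNReal.ofReal (Δ k ω ^ 2) ∂P ≤ ENNReal.ofReal (C * 16⁻¹ ^ k)) :
    ∀ᵐ ω ∂P, Summable fun k => |Δ k ω| := by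
  have h1 : ∀ k, ∫⁻ ω, ENNReal.ofReal |Δ k ω| ∂P ≤ ENNReal.ofReal ((1 + |C|) * 4⁻¹ ^ k) := by
    intro k
    have hpt : ∀ ω, ENNReal.ofReal |Δ k ω| ≤
        ENNReal.ofReal (4⁻¹ ^ k) + ENNReal.ofReal (4 ^ k) * ENNReal.ofReal (Δ k ω ^ 2) := by
      intro ω
      rw [← ENNReal.ofReal_mul (by positivity), ← ENNReal.ofReal_add (by positivity)
        (by positivity)]
      refine ENNReal.ofReal_le_ofReal ?_
      have h4 : (0 : ℝ) < 4 ^ k := by positivity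
      have h5 : (4⁻¹ : ℝ) ^ k * 4 ^ k = 1 := by rw [← mul_pow]; norm_num
      have h6 : |Δ k ω| ^ 2 = Δ k ω ^ 2 := sq_abs _
      have h7 := abs_nonneg (Δ k ω)
      have h8 : |Δ k ω| * 4 ^ k ≤ (4⁻¹ ^ k + 4 ^ k * Δ k ω ^ 2) * 4 ^ k := by
        rw [add_mul, h5, ← h6]
        nlinarith [sq_nonneg (|Δ k ω| * 4 ^ k - 1)]
      exact le_of_mul_le_mul_right h8 h4
    refine (lintegral_mono hpt).trans ?_
    rw [lintegral_add_left measurable_const, lintegral_const_mul' _ _ ENNReal.ofReal_ne_top,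
      lintegral_const, measure_univ, mul_one]
    refine (add_le_add le_rfl (mul_le_mul' le_rfl (h k))).trans ?_
    rw [← ENNReal.ofReal_mul (by positivity)]
    refine (add_le_add le_rfl (ENNReal.ofReal_le_ofReal
      (show _ ≤ |C| * 4⁻¹ ^ k from ?_))).trans_eq ?_
    · have : (4 : ℝ) ^ k * (C * 16⁻¹ ^ k) = C * 4⁻¹ ^ k := by
        rw [mul_left_comm, ← mul_pow]; norm_num
      rw [this]
      exact mul_le_mul_of_nonneg_right (le_abs_self _) (by positivity)
    · rw [← ENNReal.ofReal_add (by positivity) (by positivity)]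
      congr 1
      ring
  have hmm : ∀ k, Measurable fun ω => ENNReal.ofReal |Δ k ω| := fun k => (hm k).abs.ennreal_ofReal
  have h2 : ∫⁻ ω, ∑' k, ENNReal.ofReal |Δ k ω| ∂P ≠ ∞ := by
    rw [lintegral_tsum fun k => (hmm k).aemeasurable]
    refine ne_top_of_le_ne_top ?_ (ENNReal.tsum_le_tsum h1)
    have hs : Summable fun k : ℕ => (1 + |C|) * (4⁻¹ : ℝ) ^ k :=
      (summable_geometric_of_lt_one (by norm_num) (by norm_num)).mul_left _
    rw [← ENNReal.ofReal_tsum_of_nonneg (fun k => by positivity) hs]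
    exact ENNReal.ofReal_ne_top
  filter_upwards [ae_lt_top (Measurable.tsum hmm) h2] with ω hω
  have := ENNReal.summable_toReal hω.ne
  simpa [ENNReal.toReal_ofReal] using this

/-- **Convex compactness** in `L₀`. A downward directed family, indexed by finite sets, of nonempty
convex sets which are closed under almost sure convergence and bounded in `L₁` has a common element.
Near-minimizers of the strictly convex functional `E √(1 + ξ²)` along the family form a Cauchy
sequence, and its limit does not depend on their choice. -/
theorem exists_forall_mem_of_convex_of_bounded [IsProbabilityMeasure P] {α : Type*}
    {D : Finset α → Set (Ω →ₘ[P] ℝ)} (hanti : ∀ F G, F ⊆ G → D G ⊆ D F)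
    (hne : ∀ F, (D F).Nonempty) (hconv : ∀ F, Convex ℝ (D F))
    (hclosed : ∀ F (u : ℕ → Ω →ₘ[P] ℝ) ξ, (∀ n, u n ∈ D F) →
      (∀ᵐ ω ∂P, Tendsto (fun n => u n ω) atTop (𝓝 (ξ ω))) → ξ ∈ D F)
    {M : ℝ} (hint : ∀ F, ∀ ξ ∈ D F, Integrable ξ P) (hM : ∀ F, ∀ ξ ∈ D F, ∫ ω, |ξ ω| ∂P ≤ M) :
    ∃ ξ, ∀ F, ξ ∈ D F := by
  classical
  set J : (Ω →ₘ[P] ℝ) → ℝ := fun ξ => ∫ ω, √(1 + ξ ω ^ 2) ∂P with hJ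
  have hmeas : ∀ ξ : Ω →ₘ[P] ℝ, Measurable ξ := fun ξ => ξ.stronglyMeasurable.measurable
  have hsqm : ∀ f : Ω → ℝ, Measurable f → Measurable fun ω => √(1 + f ω ^ 2) := fun f hf =>
    Real.continuous_sqrt.measurable.comp ((hf.pow_const 2).const_add 1)
  have hsq : ∀ x : ℝ, √(1 + x ^ 2) ≤ 1 + |x| := fun x => by
    rw [Real.sqrt_le_left (by positivity)]
    nlinarith [abs_nonneg x, sq_abs x]
  have hJint' : ∀ f : Ω → ℝ, Measurable f → Integrable f P →
      Integrable (fun ω => √(1 + f ω ^ 2)) P := fun f hf hfi => by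
    refine ((integrable_const 1).add hfi.abs).mono' (hsqm f hf).aestronglyMeasurable
      (Eventually.of_forall fun ω => ?_)
    rw [Real.norm_eq_abs, abs_of_nonneg (Real.sqrt_nonneg _)]
    exact hsq _
  have hJint : ∀ F, ∀ ξ ∈ D F, Integrable (fun ω => √(1 + ξ ω ^ 2)) P := fun F ξ hξ =>
    hJint' _ (hmeas ξ) (hint F ξ hξ)
  have hJ0 : ∀ ξ, 0 ≤ J ξ := fun ξ => integral_nonneg fun ω => Real.sqrt_nonneg _
  have hJM : ∀ F, ∀ ξ ∈ D F, J ξ ≤ 1 + M := fun F ξ hξ => by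
    refine (integral_mono (hJint F ξ hξ) ((integrable_const (1 : ℝ)).add (hint F ξ hξ).abs)
      fun ω => hsq _).trans ?_
    simp only [Pi.add_apply]
    rw [integral_add (integrable_const _) (hint F ξ hξ).abs]
    simpa using hM F ξ hξ
  set s : Finset α → ℝ := fun F => sInf (J '' D F) with hs
  have hbelow : ∀ F, BddBelow (J '' D F) := fun F =>
    ⟨0, by rintro _ ⟨ξ, -, rfl⟩; exact hJ0 ξ⟩
  have hsle : ∀ F, ∀ ξ ∈ D F, s F ≤ J ξ := fun F ξ hξ => csInf_le (hbelow F) ⟨ξ, hξ, rfl⟩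
  have habove : BddAbove (range s) := ⟨1 + M, by
    rintro _ ⟨F, rfl⟩
    obtain ⟨ξ, hξ⟩ := hne F
    exact (hsle F ξ hξ).trans (hJM F ξ hξ)⟩
  set S := ⨆ F, s F with hS
  have hε : ∀ k : ℕ, (0 : ℝ) < 16⁻¹ ^ k := fun k => by positivity
  have hG : ∀ k : ℕ, ∃ G, S - 16⁻¹ ^ k < s G := fun k =>
    exists_lt_of_lt_ciSup (sub_lt_self _ (hε k))
  choose G hG using hG
  set F : ℕ → Finset α := fun k => (Finset.range (k + 1)).biUnion G with hF
  have hGF : ∀ k, G k ⊆ F k := fun k =>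
    Finset.subset_biUnion_of_mem G (Finset.mem_range.2 (Nat.lt_succ_self k))
  have hFF : ∀ k, F k ⊆ F (k + 1) := fun k =>
    Finset.biUnion_subset_biUnion_of_subset_left _ (Finset.range_mono (by omega))
  have hmin : ∀ k H, ∃ ξ ∈ D H, J ξ ≤ S + 16⁻¹ ^ k := fun k H => by
    obtain ⟨_, ⟨ξ, hξ, rfl⟩, h⟩ := exists_lt_of_csInf_lt ((hne H).image J)
      (lt_add_of_pos_right (s H) (hε k))
    exact ⟨ξ, hξ, by linarith [le_ciSup habove H]⟩
  -- two near-minimizers over the same set are close, because their midpoint lies in the set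
  have hclose : ∀ k, ∀ ξ ∈ D (F k), ∀ ζ ∈ D (F k), J ξ ≤ S + 16⁻¹ ^ k → J ζ ≤ S + 16⁻¹ ^ k →
      ∫⁻ ω, ENNReal.ofReal ((squash (ξ ω) - squash (ζ ω)) ^ 2) ∂P
        ≤ ENNReal.ofReal (16 * 16⁻¹ ^ k) := by
    intro k ξ hξ ζ hζ h1 h2
    have hmid : (1 / 2 : ℝ) • ξ + (1 / 2 : ℝ) • ζ ∈ D (F k) :=
      hconv _ hξ hζ (by norm_num) (by norm_num) (by norm_num)
    have hJmid : J ((1 / 2 : ℝ) • ξ + (1 / 2 : ℝ) • ζ)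
        = ∫ ω, √(1 + ((ξ ω + ζ ω) / 2) ^ 2) ∂P := by
      refine integral_congr_ae ?_
      filter_upwards [AEEqFun.coeFn_add ((1 / 2 : ℝ) • ξ) ((1 / 2 : ℝ) • ζ),
        AEEqFun.coeFn_smul (1 / 2 : ℝ) ξ, AEEqFun.coeFn_smul (1 / 2 : ℝ) ζ] with ω h3 h4 h5
      rw [h3, Pi.add_apply, h4, h5]
      simp only [Pi.smul_apply, smul_eq_mul]
      ring_nf
    have hi3 : Integrable (fun ω => √(1 + ((ξ ω + ζ ω) / 2) ^ 2)) P :=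
      hJint' (fun ω => (ξ ω + ζ ω) / 2) (((hmeas ξ).add (hmeas ζ)).div_const 2)
        (((hint _ ξ hξ).add (hint _ ζ hζ)).div_const 2)
    have h6 : S - 16⁻¹ ^ k ≤ ∫ ω, √(1 + ((ξ ω + ζ ω) / 2) ^ 2) ∂P := by
      rw [← hJmid]
      exact (hG k).le.trans (hsle _ _ (hanti _ _ (hGF k) hmid))
    have hi1 := hJint _ ξ hξ
    have hi2 := hJint _ ζ hζ
    have hgi : Integrable (fun ω => 8 * ((√(1 + ξ ω ^ 2) + √(1 + ζ ω ^ 2)) / 2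
        - √(1 + ((ξ ω + ζ ω) / 2) ^ 2))) P := (((hi1.add hi2).div_const 2).sub hi3).const_mul 8
    refine (lintegral_mono fun ω => ENNReal.ofReal_le_ofReal (sq_squash_sub_le _ _)).trans ?_
    rw [← ofReal_integral_eq_lintegral_ofReal hgi (Eventually.of_forall fun ω =>
      (sq_nonneg _).trans (sq_squash_sub_le _ _))]
    refine ENNReal.ofReal_le_ofReal ?_
    have hi12 : Integrable (fun ω => (√(1 + ξ ω ^ 2) + √(1 + ζ ω ^ 2)) / 2) P :=
      (hi1.add hi2).div_const 2
    rw [integral_const_mul, integral_sub hi12 hi3, integral_div, integral_add hi1 hi2]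
    simp only [hJ] at h1 h2
    linarith
  choose ξ hξD hξJ using fun k => hmin k (F k)
  have hsm : ∀ ζ : Ω →ₘ[P] ℝ, Measurable fun ω => squash (ζ ω) := fun ζ =>
    continuous_squash.measurable.comp (hmeas ζ)
  have hcauchy : ∀ᵐ ω ∂P, ∃ t, Tendsto (fun k => squash (ξ k ω)) atTop (𝓝 t) := by
    have := ae_summable_abs_of_lintegral_sq_le (P := P) (C := 16)
      (Δ := fun k ω => squash (ξ k ω) - squash (ξ (k + 1) ω))
      (fun k => (hsm _).sub (hsm _)) fun k => hclose k _ (hξD k) _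
        (hanti _ _ (hFF k) (hξD (k + 1))) (hξJ k) ((hξJ (k + 1)).trans (by
          rw [pow_succ]; nlinarith [hε k]))
    filter_upwards [this] with ω hω
    exact cauchySeq_tendsto_of_complete (cauchySeq_of_summable_dist hω)
  -- the limit is finite by Fatou's lemma
  have hfatou : ∀ᵐ ω ∂P, liminf (fun k => ENNReal.ofReal |ξ k ω|) atTop < ∞ := by
    have hm : ∀ k, Measurable fun ω => ENNReal.ofReal |ξ k ω| := fun k =>
      (hmeas _).abs.ennreal_ofReal
    refine ae_lt_top (Measurable.liminf hm) (ne_top_of_le_ne_top ENNReal.ofReal_ne_top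
      ((lintegral_liminf_le hm).trans ((liminf_le_liminf
        (v := fun _ => ENNReal.ofReal M) (Eventually.of_forall fun k => ?_)).trans_eq
          (liminf_const _))))
    rw [← ofReal_integral_eq_lintegral_ofReal (hint _ _ (hξD k)).abs
      (Eventually.of_forall fun ω => abs_nonneg _)]
    exact ENNReal.ofReal_le_ofReal (hM _ _ (hξD k))
  have hconvg : ∀ᵐ ω ∂P, ∃ x, Tendsto (fun k => ξ k ω) atTop (𝓝 x) := by
    filter_upwards [hcauchy, hfatou] with ω ⟨t, ht⟩ hω
    obtain ⟨R, hR0, hR⟩ := ENNReal.lt_iff_exists_real_btwn.1 hω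
    have hfreq := frequently_lt_of_liminf_lt (h := hR.1)
    have hle : t ^ 2 ≤ R ^ 2 / (1 + R ^ 2) := by
      by_contra! hlt
      obtain ⟨k, hk, hk3⟩ := (hfreq.and_eventually ((ht.pow 2).eventually_const_lt hlt)).exists
      have hk' : |ξ k ω| < R := by
        by_contra! h
        exact absurd (ENNReal.ofReal_le_ofReal h) (not_le.2 hk)
      have hk2 : ξ k ω ^ 2 ≤ R ^ 2 := by
        rw [← sq_abs]
        exact pow_le_pow_left₀ (abs_nonneg _) hk'.le 2
      rw [squash_sq, div_lt_div_iff₀ (by positivity) (by positivity)] at hk3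
      nlinarith
    have ht1 : |t| < 1 := by
      rw [← sq_lt_one_iff_abs_lt_one]
      exact hle.trans_lt ((div_lt_one (by positivity)).2 (by linarith))
    exact ⟨_, tendsto_of_tendsto_squash ht1 ht⟩
  obtain ⟨g, hg, hlim⟩ := measurable_limit_of_tendsto_metrizable_ae
    (fun k => (hmeas (ξ k)).aemeasurable) hconvg
  refine ⟨AEEqFun.mk g hg.aestronglyMeasurable, fun H => ?_⟩
  choose ζ hζD hζJ using fun k => hmin k (F k ∪ H)
  refine hclosed H ζ _ (fun k => hanti _ _ Finset.subset_union_right (hζD k)) ?_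
  have hdiff := ae_summable_abs_of_lintegral_sq_le (P := P) (C := 16)
    (Δ := fun k ω => squash (ξ k ω) - squash (ζ k ω))
    (fun k => (hsm _).sub (hsm _)) fun k => hclose k _ (hξD k) _
      (hanti _ _ Finset.subset_union_left (hζD k)) (hξJ k) (hζJ k)
  filter_upwards [hdiff, hlim, AEEqFun.coeFn_mk g hg.aestronglyMeasurable] with ω h1 h2 h3
  rw [h3]
  have h4 : Tendsto (fun k => squash (ξ k ω) - squash (ζ k ω)) atTop (𝓝 0) :=
    (tendsto_zero_iff_abs_tendsto_zero _).2 h1.tendsto_atTop_zero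
  have h5 : Tendsto (fun k => squash (ζ k ω)) atTop (𝓝 (squash (g ω))) := by
    simpa using ((continuous_squash.tendsto _).comp h2).sub h4
  simpa [squash_div_sqrt] using tendsto_of_tendsto_squash (abs_squash_lt_one _) h5

end ConvexCompactness

/-! ### Polar balls and modulars -/

section Polar

variable {Ω : Type*} [MeasurableSpace Ω] {P : Measure Ω} {Φ : YoungFunction}

/-- The unit ball of the Orlicz space for the Luxemburg norm: the elements of modular at most one. -/
def modularBall (P : Measure Ω) (Φ : YoungFunction) : Set (orliczSpace P Φ) :=
  {η | ∫⁻ ω, ENNReal.ofReal (Φ ((η : Ω →ₘ[P] ℝ) ω)) ∂P ≤ 1}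

/-- The ball of radius `r` of `L_{Φ*}` for the norm dual to the Luxemburg norm of `L_Φ`. -/
def dualBall (P : Measure Ω) (Φ : YoungFunction) (r : ℝ) : Set (orliczSpace P Φ.conj) :=
  {ξ | ∀ η ∈ modularBall P Φ, |orliczPairing P Φ ξ η| ≤ r}

theorem dualBall_eq_iInter (r : ℝ) :
    dualBall P Φ r = ⋂ η : modularBall P Φ, {ξ | |orliczPairing P Φ ξ η| ≤ r} := by
  ext ξ; simp [dualBall]

theorem isOrderClosed_dualBall (r : ℝ) : IsOrderClosed (dualBall P Φ r) := by
  rw [dualBall_eq_iInter]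
  exact isOrderClosed_iInter fun η => isOrderClosed_abs_orliczPairing_le _ _

theorem convex_dualBall (r : ℝ) : Convex ℝ (dualBall P Φ r) := by
  rw [dualBall_eq_iInter]
  exact convex_iInter fun η => convex_abs_orliczPairing_le _ _

/-- Scaling by a factor `t ≤ 1` multiplies the modular by at most `t`. -/
theorem lintegral_ofReal_smul_le {η : Ω →ₘ[P] ℝ} {t : ℝ} (h0 : 0 ≤ t) (h1 : t ≤ 1) :
    ∫⁻ ω, ENNReal.ofReal (Φ ((t • η : Ω →ₘ[P] ℝ) ω)) ∂P ≤
      ENNReal.ofReal t * ∫⁻ ω, ENNReal.ofReal (Φ (η ω)) ∂P := by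
  rw [← lintegral_const_mul' _ _ ENNReal.ofReal_ne_top]
  refine lintegral_mono_ae ?_
  filter_upwards [AEEqFun.coeFn_smul t η] with ω hω
  rw [hω, Pi.smul_apply, smul_eq_mul, ← ENNReal.ofReal_mul h0]
  exact ENNReal.ofReal_le_ofReal (Φ.mul_le_mul h0 h1)

theorem smul_mem_modularBall {η : orliczSpace P Φ} {t : ℝ} (h0 : 0 ≤ t) (h1 : t ≤ 1)
    (hη : η ∈ modularBall P Φ) : t • η ∈ modularBall P Φ :=
  (lintegral_ofReal_smul_le h0 h1).trans
    ((mul_le_mul' (ENNReal.ofReal_le_one.2 h1) hη).trans_eq (one_mul _))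

/-- Elements of `L_{Φ*}` are bounded on the unit ball of `L_Φ`. -/
theorem exists_integral_abs_mul_le {ξ : Ω →ₘ[P] ℝ} (hξ : ξ ∈ orliczSpace P Φ.conj) :
    ∃ C : ℝ, 0 ≤ C ∧ ∀ η ∈ modularBall P Φ, ∫ ω, |(η : Ω →ₘ[P] ℝ) ω * ξ ω| ∂P ≤ C := by
  obtain ⟨c, hc, hfin⟩ := id hξ
  refine ⟨c⁻¹ * (1 + (∫⁻ ω, ENNReal.ofReal (Φ.conj (c * ξ ω)) ∂P).toReal), by positivity,
    fun η hη => ?_⟩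
  have h1 : ∫⁻ ω, ENNReal.ofReal (c * |(η : Ω →ₘ[P] ℝ) ω * ξ ω|) ∂P ≤
      1 + ∫⁻ ω, ENNReal.ofReal (Φ.conj (c * ξ ω)) ∂P := by
    refine (lintegral_mono (g := fun ω => ENNReal.ofReal (Φ ((η : Ω →ₘ[P] ℝ) ω)) +
      ENNReal.ofReal (Φ.conj (c * ξ ω))) fun ω => ?_).trans ?_
    · simp only
      rw [← ENNReal.ofReal_add (Φ.nonneg _) (Φ.conj.nonneg _)]
      refine ENNReal.ofReal_le_ofReal ?_
      have := Φ.young_abs ((η : Ω →ₘ[P] ℝ) ω) (c * ξ ω)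
      rwa [mul_left_comm, abs_mul, abs_of_pos hc] at this
    · rw [lintegral_add_right' _ (Φ.conj.aemeasurable_comp P c ξ)]
      exact add_le_add hη le_rfl
  have hint := integrable_mul_of_mem_orliczSpace P Φ η.2 hξ
  rw [← ofReal_integral_eq_lintegral_ofReal (hint.abs.const_mul c)
    (Eventually.of_forall fun ω => by positivity), integral_const_mul,
    ENNReal.ofReal_le_iff_le_toReal (ENNReal.add_ne_top.2 ⟨ENNReal.one_ne_top, hfin.ne⟩),
    ENNReal.toReal_add ENNReal.one_ne_top hfin.ne, ENNReal.toReal_one] at h1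
  rwa [inv_mul_eq_div, le_div_iff₀ hc, mul_comm]

/-- The conjugate is the increasing limit of affine functions selected by bounded measurable
functions. -/
theorem YoungFunction.exists_selection (Φ : YoungFunction) :
    ∃ h : ℕ → ℝ → ℝ, (∀ n, Measurable (h n)) ∧ (∀ n, ∃ C, ∀ y, |h n y| ≤ C) ∧
      (∀ n y, 0 ≤ h n y * y - Φ (h n y)) ∧
      (∀ y, Monotone fun n => h n y * y - Φ (h n y)) ∧
      ∀ y, ENNReal.ofReal (Φ.conj y) ≤ ⨆ n, ENNReal.ofReal (h n y * y - Φ (h n y)) := by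
  classical
  let q : ℕ → ℝ := TopologicalSpace.denseSeq ℝ
  let h : ℕ → ℝ → ℝ := fun n => Nat.rec (fun _ => 0)
    (fun n hn y => if hn y * y - Φ (hn y) < q n * y - Φ (q n) then q n else hn y) n
  have h0 : ∀ y, h 0 y = 0 := fun y => rfl
  have hs : ∀ n y, h (n + 1) y =
    if h n y * y - Φ (h n y) < q n * y - Φ (q n) then q n else h n y := fun n y => rfl
  have hstep : ∀ n y, h n y * y - Φ (h n y) ≤ h (n + 1) y * y - Φ (h (n + 1) y) := by
    intro n y
    rw [hs]
    split_ifs with hlt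
    · exact hlt.le
    · exact le_rfl
  have hq : ∀ n y, q n * y - Φ (q n) ≤ h (n + 1) y * y - Φ (h (n + 1) y) := by
    intro n y
    rw [hs]
    split_ifs with hlt
    · exact le_rfl
    · exact not_lt.1 hlt
  have hmono : ∀ y, Monotone fun n => h n y * y - Φ (h n y) := fun y =>
    monotone_nat_of_le_succ fun n => hstep n y
  refine ⟨h, ?_, ?_, ?_, hmono, ?_⟩
  · intro n
    induction n with
    | zero => exact measurable_const
    | succ n ih =>
      have : h (n + 1) = fun y =>
        if h n y * y - Φ (h n y) < q n * y - Φ (q n) then q n else h n y := funext (hs n)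
      rw [this]
      refine Measurable.ite (measurableSet_lt ?_ ?_) measurable_const ih
      · exact (ih.mul measurable_id).sub (Φ.continuous.measurable.comp ih)
      · exact (measurable_id.const_mul _).sub_const _
  · intro n
    induction n with
    | zero => exact ⟨0, fun y => by simp [h0]⟩
    | succ n ih =>
      obtain ⟨C, hC⟩ := ih
      refine ⟨max C |q n|, fun y => ?_⟩
      rw [hs]
      split_ifs
      · exact le_max_right _ _
      · exact (hC y).trans (le_max_left _ _)
  · intro n y
    have := hmono y (Nat.zero_le n)
    simpa [h0, Φ.zero'] using this
  · intro y
    by_cases htop : ⨆ n, ENNReal.ofReal (h n y * y - Φ (h n y)) = ∞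
    · rw [htop]; exact le_top
    · rw [ENNReal.ofReal_le_iff_le_toReal htop]
      set C := (⨆ n, ENNReal.ofReal (h n y * y - Φ (h n y))).toReal
      have hqC : ∀ n, q n * y - Φ (q n) ≤ C := fun n => (hq n y).trans
        ((ENNReal.ofReal_le_iff_le_toReal htop).1
          (le_iSup (fun n => ENNReal.ofReal (h n y * y - Φ (h n y))) (n + 1)))
      have hcl : IsClosed {x : ℝ | x * y - Φ x ≤ C} :=
        isClosed_le ((continuous_id.mul continuous_const).sub Φ.continuous) continuous_const
      have huniv : ∀ x : ℝ, x * y - Φ x ≤ C := fun x =>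
        closure_minimal (by rintro _ ⟨n, rfl⟩; exact hqC n) hcl
          (TopologicalSpace.denseRange_denseSeq ℝ x)
      exact ciSup_le huniv

/-- An element of the polar of the unit ball of `L_Φ` has `Φ*`-modular at most one. -/
theorem lintegral_conj_le_one_of_mem_dualBall [IsProbabilityMeasure P] {ξ : orliczSpace P Φ.conj}
    {r : ℝ} (hr : 0 < r) (hξ : ξ ∈ dualBall P Φ r) :
    ∫⁻ ω, ENNReal.ofReal (Φ.conj (r⁻¹ * (ξ : Ω →ₘ[P] ℝ) ω)) ∂P ≤ 1 := by
  have hξm : Measurable (ξ : Ω →ₘ[P] ℝ) := (ξ : Ω →ₘ[P] ℝ).stronglyMeasurable.measurable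
  -- a bound by `1 + E Φ(η)` for arbitrary `η` of finite modular, by scaling
  have hbound : ∀ η : orliczSpace P Φ, Integrable (fun ω => Φ ((η : Ω →ₘ[P] ℝ) ω)) P →
      r⁻¹ * orliczPairing P Φ ξ η ≤ 1 + ∫ ω, Φ ((η : Ω →ₘ[P] ℝ) ω) ∂P := by
    intro η hη
    set m := ∫ ω, Φ ((η : Ω →ₘ[P] ℝ) ω) ∂P with hm
    have hm0 : 0 ≤ m := integral_nonneg fun ω => Φ.nonneg _
    have hmod : ∫⁻ ω, ENNReal.ofReal (Φ ((η : Ω →ₘ[P] ℝ) ω)) ∂P = ENNReal.ofReal m :=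
      (ofReal_integral_eq_lintegral_ofReal hη (Eventually.of_forall fun ω => Φ.nonneg _)).symm
    have hpos : 0 < 1 + m := by linarith
    have hball : (1 + m)⁻¹ • η ∈ modularBall P Φ := by
      refine (lintegral_ofReal_smul_le (by positivity)
        (inv_le_one_of_one_le₀ (by linarith))).trans ?_
      rw [hmod, ← ENNReal.ofReal_mul (by positivity), ENNReal.ofReal_le_one,
        inv_mul_le_one₀ hpos]
      linarith
    have h1 := (le_abs_self _).trans (hξ _ hball)
    rw [map_smul, smul_eq_mul, inv_mul_le_iff₀ hpos] at h1
    rw [inv_mul_le_iff₀ hr]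
    linarith
  obtain ⟨h, hm, hC, h0, hmono, hsup⟩ := Φ.exists_selection
  set x : Ω → ℝ := fun ω => r⁻¹ * (ξ : Ω →ₘ[P] ℝ) ω with hx
  have hxm : Measurable x := hξm.const_mul _
  have hgm : ∀ n, Measurable fun ω => h n (x ω) * x ω - Φ (h n (x ω)) := fun n =>
    (((hm n).comp hxm).mul hxm).sub (Φ.continuous.measurable.comp ((hm n).comp hxm))
  refine (lintegral_mono fun ω => hsup (x ω)).trans ?_
  rw [lintegral_iSup (fun n => (hgm n).ennreal_ofReal)
    fun n k hnk ω => ENNReal.ofReal_le_ofReal (hmono (x ω) hnk)]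
  refine iSup_le fun n => ?_
  obtain ⟨C, hC⟩ := hC n
  have hηm : AEStronglyMeasurable (fun ω => h n (x ω)) P := ((hm n).comp hxm).aestronglyMeasurable
  have hcoe := AEEqFun.coeFn_mk _ hηm
  have hηmem : AEEqFun.mk _ hηm ∈ orliczSpace P Φ := by
    refine mem_orliczSpace_of_bounded (C := C) ?_
    filter_upwards [hcoe] with ω hω
    rw [hω]
    exact hC _
  have hΦi : Integrable (fun ω => Φ (h n (x ω))) P := by
    refine Integrable.of_bound (C := Φ C)
      (Φ.continuous.measurable.comp ((hm n).comp hxm)).aestronglyMeasurable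
      (Eventually.of_forall fun ω => ?_)
    rw [Real.norm_eq_abs, abs_of_nonneg (Φ.nonneg _)]
    exact Φ.mono_abs ((hC _).trans (le_abs_self _))
  have hΦi' : Integrable (fun ω => Φ ((AEEqFun.mk _ hηm : Ω →ₘ[P] ℝ) ω)) P :=
    hΦi.congr (hcoe.mono fun ω hω => by simp only [hω])
  have h1 := hbound ⟨_, hηmem⟩ hΦi'
  have hpi : Integrable (fun ω => h n (x ω) * x ω) P := by
    refine ((integrable_mul_of_mem_orliczSpace P Φ hηmem ξ.2).const_mul r⁻¹).congr
      (hcoe.mono fun ω hω => ?_)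
    simp only [hω]
    simp only [hx]
    ring
  have h2 : r⁻¹ * orliczPairing P Φ ξ ⟨_, hηmem⟩ = ∫ ω, h n (x ω) * x ω ∂P := by
    rw [orliczPairing_apply, ← integral_const_mul]
    refine integral_congr_ae (hcoe.mono fun ω hω => ?_)
    simp only [hω]
    simp only [hx]
    ring
  have h3 : ∫ ω, Φ ((AEEqFun.mk _ hηm : Ω →ₘ[P] ℝ) ω) ∂P = ∫ ω, Φ (h n (x ω)) ∂P :=
    integral_congr_ae (hcoe.mono fun ω hω => by simp only [hω])
  rw [h2, h3] at h1
  have hdi : Integrable (fun ω => h n (x ω) * x ω - Φ (h n (x ω))) P := hpi.sub hΦi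
  rw [← ofReal_integral_eq_lintegral_ofReal hdi (Eventually.of_forall fun ω => h0 _ _),
    ENNReal.ofReal_le_one, integral_sub hpi hΦi]
  linarith

/-- The dual balls are bounded in `L₁`. -/
theorem integral_abs_le_of_mem_dualBall [IsProbabilityMeasure P] {ξ : orliczSpace P Φ.conj}
    {r : ℝ} (hr : 0 < r) (hξ : ξ ∈ dualBall P Φ r) :
    Integrable (ξ : Ω →ₘ[P] ℝ) P ∧ ∫ ω, |(ξ : Ω →ₘ[P] ℝ) ω| ∂P ≤ r * (Φ 1 + 1) := by
  have h1 := lintegral_conj_le_one_of_mem_dualBall hr hξ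
  have hfin : ∫⁻ ω, ENNReal.ofReal |(ξ : Ω →ₘ[P] ℝ) ω| ∂P ≤ ENNReal.ofReal (r * (Φ 1 + 1)) := by
    calc ∫⁻ ω, ENNReal.ofReal |(ξ : Ω →ₘ[P] ℝ) ω| ∂P
        ≤ ∫⁻ ω, ENNReal.ofReal r * (ENNReal.ofReal (Φ 1) +
            ENNReal.ofReal (Φ.conj (r⁻¹ * (ξ : Ω →ₘ[P] ℝ) ω))) ∂P := by
          refine lintegral_mono fun ω => ?_
          rw [← ENNReal.ofReal_add (Φ.nonneg _) (Φ.conj.nonneg _), ← ENNReal.ofReal_mul hr.le]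
          refine ENNReal.ofReal_le_ofReal ?_
          have := Φ.young_abs 1 (r⁻¹ * (ξ : Ω →ₘ[P] ℝ) ω)
          rw [one_mul, abs_mul, abs_of_pos (inv_pos.2 hr), inv_mul_le_iff₀ hr] at this
          exact this
      _ ≤ ENNReal.ofReal r * (ENNReal.ofReal (Φ 1) + 1) := by
          rw [lintegral_const_mul' _ _ ENNReal.ofReal_ne_top, lintegral_add_left measurable_const,
            lintegral_const, measure_univ, mul_one]
          exact mul_le_mul' le_rfl (add_le_add le_rfl h1)
      _ = ENNReal.ofReal (r * (Φ 1 + 1)) := by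
          rw [ENNReal.ofReal_mul hr.le, ENNReal.ofReal_add (Φ.nonneg _) zero_le_one,
            ENNReal.ofReal_one]
  have hint : Integrable (ξ : Ω →ₘ[P] ℝ) P := by
    refine ⟨(ξ : Ω →ₘ[P] ℝ).aestronglyMeasurable, ?_⟩
    rw [hasFiniteIntegral_iff_norm]
    exact hfin.trans_lt ENNReal.ofReal_lt_top
  refine ⟨hint, ?_⟩
  rw [← ofReal_integral_eq_lintegral_ofReal hint.abs (Eventually.of_forall fun ω => abs_nonneg _),
    ENNReal.ofReal_le_ofReal_iff (mul_nonneg hr.le (add_nonneg (Φ.nonneg _) zero_le_one))] at hfin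
  exact hfin

end Polar

/-! ### Summable combinations of functionals -/

section NullFamilies

variable {ι : Type*}

/-- On null families, a continuous linear functional on `ℓ^∞` is given by a summable family. -/
theorem exists_summable_hasSum_of_tendsto_zero (f : StrongDual ℝ (lp (fun _ : ι => ℝ) ∞)) :
    ∃ c : ι → ℝ, (Summable fun i => |c i|) ∧ ∀ a : lp (fun _ : ι => ℝ) ∞,
      Tendsto (fun i => a i) cofinite (𝓝 0) → HasSum (fun i => c i * a i) (f a) := by
  classical
  have hsum : ∀ (s : Finset ι) (a : ι → ℝ) (i : ι),
      (∑ j ∈ s, lp.single (E := fun _ : ι => ℝ) ∞ j (a j) : lp (fun _ : ι => ℝ) ∞) i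
        = if i ∈ s then a i else 0 := by
    intro s a i
    rw [lp.coeFn_sum, Finset.sum_apply]
    simp only [lp.coeFn_single, Finset.sum_pi_single]
  have hsingle : ∀ i (x : ℝ), f (lp.single (E := fun _ : ι => ℝ) ∞ i x)
      = f (lp.single (E := fun _ : ι => ℝ) ∞ i 1) * x := by
    intro i x
    have : lp.single (E := fun _ : ι => ℝ) ∞ i x
        = x • lp.single (E := fun _ : ι => ℝ) ∞ i (1 : ℝ) := by
      rw [← lp.single_smul, smul_eq_mul, mul_one]
    rw [this, map_smul, smul_eq_mul, mul_comm]
  refine ⟨fun i => f (lp.single (E := fun _ : ι => ℝ) ∞ i 1), ?_, ?_⟩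
  · refine summable_of_sum_le (c := ‖f‖) (fun i => abs_nonneg _) fun s => ?_
    set g : lp (fun _ : ι => ℝ) ∞ := ∑ j ∈ s, lp.single (E := fun _ : ι => ℝ) ∞ j
      ((SignType.sign (f (lp.single (E := fun _ : ι => ℝ) ∞ j 1)) : ℝ)) with hg
    have h1 : f g = ∑ i ∈ s, |f (lp.single (E := fun _ : ι => ℝ) ∞ i 1)| := by
      rw [hg, map_sum]
      refine Finset.sum_congr rfl fun i _ => ?_
      rw [hsingle, mul_comm, sign_mul_self]
    have h2 : ‖g‖ ≤ 1 := by
      refine lp.norm_le_of_forall_le zero_le_one fun i => ?_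
      rw [hg, hsum]
      split_ifs
      · rcases lt_trichotomy (f (lp.single (E := fun _ : ι => ℝ) ∞ i 1)) 0 with h | h | h <;>
          simp [h]
      · simp
    rw [← h1]
    exact (le_abs_self _).trans ((f.le_opNorm g).trans
      (mul_le_of_le_one_right (norm_nonneg _) h2))
  · intro a ha
    have hs : HasSum (fun i => lp.single (E := fun _ : ι => ℝ) ∞ i (a i)) a := by
      rw [HasSum, SummationFilter.unconditional_filter, Metric.tendsto_atTop]
      intro ε hε
      have hfin : {i | ¬ |a i| < ε / 2}.Finite := by
        have := (Metric.tendsto_nhds.1 ha) (ε / 2) (by positivity)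
        simpa [Real.dist_eq] using this
      refine ⟨hfin.toFinset, fun s hs => ?_⟩
      rw [dist_eq_norm]
      refine (lp.norm_le_of_forall_le (C := ε / 2) (by positivity) fun i => ?_).trans_lt
        (by linarith)
      rw [lp.coeFn_sub, Pi.sub_apply, hsum]
      split_ifs with hi
      · simpa using (half_pos hε).le
      · have : |a i| < ε / 2 := by
          by_contra h
          exact hi (hs (hfin.mem_toFinset.2 h))
        simpa using this.le
    refine (f.hasSum hs).congr_fun fun i => ?_
    exact (hsingle i (a i)).symm

/-- If the functionals `T i` tend to zero pointwise, and each point of a convex set `C` violates one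
of the inequalities `|T i x| ≤ 1`, then a summable combination of them is bounded below by a
positive constant on `C`. -/
theorem exists_summable_separating {E : Type*} [AddCommGroup E] [Module ℝ E] {C : Set E}
    (hC : Convex ℝ C) (T : ι → E →ₗ[ℝ] ℝ) (hnull : ∀ x, Tendsto (fun i => T i x) cofinite (𝓝 0))
    (h : ∀ x ∈ C, ∃ i, 1 < |T i x|) :
    ∃ c : ι → ℝ, (Summable fun i => |c i|) ∧ ∃ u : ℝ, 0 < u ∧
      ∀ x ∈ C, ∃ v, u ≤ v ∧ HasSum (fun i => c i * T i x) v := by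
  have hmem : ∀ x, Memℓp (fun i => T i x) ∞ := fun x =>
    memℓp_infty (hnull x).norm.bddAbove_range_of_cofinite
  let A : E →ₗ[ℝ] lp (fun _ : ι => ℝ) ∞ :=
    { toFun := fun x => ⟨fun i => T i x, hmem x⟩
      map_add' := fun x y => by ext i; exact map_add (T i) x y
      map_smul' := fun r x => by ext i; exact map_smul (T i) r x }
  have hA : ∀ x i, A x i = T i x := fun x i => rfl
  obtain ⟨f, u, hu, hfu⟩ := geometric_hahn_banach_open (convex_ball (0 : lp (fun _ : ι => ℝ) ∞) 1)
    Metric.isOpen_ball (hC.linear_image A) (by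
      rw [Set.disjoint_left]
      rintro _ hb ⟨x, hx, rfl⟩
      obtain ⟨i, hi⟩ := h x hx
      have h1 := lp.norm_apply_le_norm ENNReal.top_ne_zero (A x) i
      rw [hA, Real.norm_eq_abs] at h1
      rw [mem_ball_zero_iff] at hb
      linarith)
  obtain ⟨c, hc, hsum⟩ := exists_summable_hasSum_of_tendsto_zero f
  refine ⟨c, hc, u, by simpa using hu 0 (by simp), fun x hx => ⟨f (A x), hfu _ ⟨x, hx, rfl⟩, ?_⟩⟩
  exact hsum (A x) (hnull x)

end NullFamilies

namespace YoungFunction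

variable (Φ : YoungFunction)

theorem apply_sum_mul_le {ι : Type*} {s : Finset ι} {t w : ι → ℝ} (ht : ∀ i ∈ s, 0 ≤ t i)
    (hs : ∑ i ∈ s, t i ≤ 1) : Φ (∑ i ∈ s, t i * w i) ≤ ∑ i ∈ s, t i * Φ (w i) := by
  have := Φ.convex'.map_add_sum_le (t := s) (w := t) (p := w) (v := 1 - ∑ i ∈ s, t i) (q := 0) ht
    (by ring) (fun _ _ => mem_univ _) (by linarith) (mem_univ _)
  simpa [Φ.zero'] using this

end YoungFunction

section SummableCombinations

variable {Ω : Type*} [MeasurableSpace Ω] {P : Measure Ω} {Φ : YoungFunction}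

/-- Summable combinations of elements of the unit ball of the Orlicz space exist, and the pairing
commutes with them. -/
theorem exists_hasSum_orliczPairing {ι : Type*} [Countable ι] {c : ι → ℝ}
    (hc : Summable fun i => |c i|) {z : ι → orliczSpace P Φ} (hz : ∀ i, z i ∈ modularBall P Φ) :
    ∃ η : orliczSpace P Φ, ∀ ξ : orliczSpace P Φ.conj,
      HasSum (fun i => c i * orliczPairing P Φ ξ (z i)) (orliczPairing P Φ ξ η) := by
  have hzm : ∀ i, Measurable (z i : Ω →ₘ[P] ℝ) := fun i =>
    (z i : Ω →ₘ[P] ℝ).stronglyMeasurable.measurable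
  set g : Ω → ℝ := fun ω => ∑' i, c i * (z i : Ω →ₘ[P] ℝ) ω with hg
  have hgm : Measurable g := Measurable.tsum fun i => (hzm i).const_mul _
  have hcoe := AEEqFun.coeFn_mk (μ := P) _ hgm.aestronglyMeasurable
  set L := 1 + ∑' i, |c i| with hL
  have hL0 : 0 < L := by
    have : 0 ≤ ∑' i, |c i| := tsum_nonneg fun i => abs_nonneg (c i)
    linarith
  have hmem : AEEqFun.mk g hgm.aestronglyMeasurable ∈ orliczSpace P Φ := by
    refine ⟨L⁻¹, inv_pos.2 hL0, ?_⟩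
    have hpt : ∀ ω, ENNReal.ofReal (Φ (L⁻¹ * g ω)) ≤
        ∑' i, ENNReal.ofReal (L⁻¹ * |c i|) * ENNReal.ofReal (Φ ((z i : Ω →ₘ[P] ℝ) ω)) := by
      intro ω
      by_cases hs : Summable fun i => c i * (z i : Ω →ₘ[P] ℝ) ω
      · have h1 := (ENNReal.continuous_ofReal.comp (Φ.continuous.comp
          (continuous_const_mul L⁻¹))).tendsto (g ω) |>.comp hs.hasSum
        refine le_of_tendsto h1 (Eventually.of_forall fun s => ?_)
        refine le_trans ?_ (ENNReal.sum_le_tsum s)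
        simp only [Function.comp_apply]
        simp_rw [← ENNReal.ofReal_mul (mul_nonneg (inv_nonneg.2 hL0.le) (abs_nonneg (c _)))]
        rw [← ENNReal.ofReal_sum_of_nonneg fun i _ =>
          mul_nonneg (mul_nonneg (inv_nonneg.2 hL0.le) (abs_nonneg (c _))) (Φ.nonneg _)]
        refine ENNReal.ofReal_le_ofReal ?_
        have h2 : L⁻¹ * ∑ i ∈ s, c i * (z i : Ω →ₘ[P] ℝ) ω = ∑ i ∈ s, (L⁻¹ * |c i|) *
            ((SignType.sign (c i) : ℝ) * (z i : Ω →ₘ[P] ℝ) ω) := by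
          rw [Finset.mul_sum]
          refine Finset.sum_congr rfl fun i _ => ?_
          rw [mul_assoc, ← mul_assoc |c i|, abs_mul_sign]
        rw [h2]
        refine (Φ.apply_sum_mul_le (fun i _ => by positivity) ?_).trans
          (Finset.sum_le_sum fun i _ => mul_le_mul_of_nonneg_left (Φ.mono_abs ?_) (by positivity))
        · rw [← Finset.mul_sum, inv_mul_le_iff₀ hL0, mul_one]
          have := hc.sum_le_tsum s fun i _ => abs_nonneg _
          linarith
        · rw [abs_mul]
          refine mul_le_of_le_one_left (abs_nonneg _) ?_
          rcases lt_trichotomy (c i) 0 with h | h | h <;> simp [h]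
      · simp [hg, tsum_eq_zero_of_not_summable hs, Φ.zero']
    calc ∫⁻ ω, ENNReal.ofReal (Φ (L⁻¹ * (AEEqFun.mk g hgm.aestronglyMeasurable : Ω →ₘ[P] ℝ) ω)) ∂P
        = ∫⁻ ω, ENNReal.ofReal (Φ (L⁻¹ * g ω)) ∂P :=
          lintegral_congr_ae (hcoe.mono fun ω hω => by simp only [hω])
      _ ≤ ∫⁻ ω, ∑' i, ENNReal.ofReal (L⁻¹ * |c i|) *
            ENNReal.ofReal (Φ ((z i : Ω →ₘ[P] ℝ) ω)) ∂P := lintegral_mono hpt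
      _ = ∑' i, ENNReal.ofReal (L⁻¹ * |c i|) *
            ∫⁻ ω, ENNReal.ofReal (Φ ((z i : Ω →ₘ[P] ℝ) ω)) ∂P := by
          have hm : ∀ i, Measurable fun ω => ENNReal.ofReal (L⁻¹ * |c i|) *
              ENNReal.ofReal (Φ ((z i : Ω →ₘ[P] ℝ) ω)) := fun i =>
            (Φ.continuous.measurable.comp (hzm i)).ennreal_ofReal.const_mul _
          rw [lintegral_tsum fun i => (hm i).aemeasurable]
          simp_rw [lintegral_const_mul' _ _ ENNReal.ofReal_ne_top]
      _ ≤ ∑' i, ENNReal.ofReal (L⁻¹ * |c i|) := ENNReal.tsum_le_tsum fun i =>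
          (mul_le_mul' le_rfl (hz i)).trans_eq (mul_one _)
      _ < ∞ := by
          rw [← ENNReal.ofReal_tsum_of_nonneg (fun i => by positivity) (hc.mul_left _)]
          exact ENNReal.ofReal_lt_top
  refine ⟨⟨_, hmem⟩, fun ξ => ?_⟩
  obtain ⟨C, hC0, hC⟩ := exists_integral_abs_mul_le ξ.2
  have hi : ∀ i, Integrable (fun ω => (z i : Ω →ₘ[P] ℝ) ω * (ξ : Ω →ₘ[P] ℝ) ω) P := fun i =>
    integrable_mul_of_mem_orliczSpace P Φ (z i).2 ξ.2
  have key := hasSum_integral_of_summable_integral_norm (μ := P)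
    (F := fun i ω => c i * ((z i : Ω →ₘ[P] ℝ) ω * (ξ : Ω →ₘ[P] ℝ) ω))
    (fun i => (hi i).const_mul _) (by
      refine Summable.of_nonneg_of_le (fun i => integral_nonneg fun ω => norm_nonneg _)
        (fun i => ?_) (hc.mul_right C)
      simp_rw [norm_mul (c i), Real.norm_eq_abs]
      rw [integral_const_mul]
      exact mul_le_mul_of_nonneg_left (hC _ (hz i)) (abs_nonneg _))
  have h1 : orliczPairing P Φ ξ ⟨_, hmem⟩
      = ∫ ω, ∑' i, c i * ((z i : Ω →ₘ[P] ℝ) ω * (ξ : Ω →ₘ[P] ℝ) ω) ∂P := by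
    rw [orliczPairing_apply]
    refine integral_congr_ae (hcoe.mono fun ω hω => ?_)
    simp only [hω]
    simp_rw [hg, ← mul_assoc, tsum_mul_right]
  rw [h1]
  simpa only [integral_const_mul, orliczPairing_apply] using key

end SummableCombinations

/-! ### Separation of order closed convex sets -/

section KreinSmulian

variable {Ω : Type*} [MeasurableSpace Ω] {P : Measure Ω} {Φ : YoungFunction}

theorem coeFn_sum_orliczSpace {Ψ : YoungFunction} (s : Finset ℕ) (u : ℕ → orliczSpace P Ψ) :
    ∀ᵐ ω ∂P, ((∑ j ∈ s, u j : orliczSpace P Ψ) : Ω →ₘ[P] ℝ) ω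
      = ∑ j ∈ s, (u j : Ω →ₘ[P] ℝ) ω := by
  induction s using Finset.cons_induction with
  | empty =>
    filter_upwards [AEEqFun.coeFn_zero (α := Ω) (β := ℝ) (μ := P)] with ω hω
    simpa using hω
  | cons a s ha ih =>
    rw [Finset.sum_cons, Submodule.coe_add]
    filter_upwards [ih, AEEqFun.coeFn_add (u a : Ω →ₘ[P] ℝ)
      ((∑ j ∈ s, u j : orliczSpace P Ψ) : Ω →ₘ[P] ℝ)] with ω h1 h2
    rw [h2, Pi.add_apply, h1, Finset.sum_cons]

/-- The bounded part of an order closed convex set is closed in `L₀` under almost sure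
convergence. -/
theorem IsOrderClosed.mem_of_tendsto_of_mem_dualBall [IsProbabilityMeasure P] (hΦ : Φ.Delta2)
    {C : Set (orliczSpace P Φ.conj)} (hC : Convex ℝ C) (hCo : IsOrderClosed C) {r : ℝ}
    (hr : 0 < r) {u : ℕ → orliczSpace P Φ.conj} (hu : ∀ n, u n ∈ C ∩ dualBall P Φ r)
    {ξ : Ω →ₘ[P] ℝ}
    (hlim : ∀ᵐ ω ∂P, Tendsto (fun n => (u n : Ω →ₘ[P] ℝ) ω) atTop (𝓝 (ξ ω))) :
    ∃ h : ξ ∈ orliczSpace P Φ.conj, (⟨ξ, h⟩ : orliczSpace P Φ.conj) ∈ C ∩ dualBall P Φ r := by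
  obtain ⟨hξ, φ, hφ, M, hM, ζ, hζ, hdom⟩ := hΦ.exists_dominated_averages (inv_pos.2 hr)
    (fun k => lintegral_conj_le_one_of_mem_dualBall hr (hu k).2) hlim
  refine ⟨hξ, ?_⟩
  set v : ℕ → orliczSpace P Φ.conj := fun n =>
    (M n : ℝ)⁻¹ • ∑ j ∈ Finset.Ico n (n + M n), u (φ j) with hv
  have hvcoe : ∀ᵐ ω ∂P, ∀ n, (v n : Ω →ₘ[P] ℝ) ω
      = (M n : ℝ)⁻¹ * ∑ j ∈ Finset.Ico n (n + M n), (u (φ j) : Ω →ₘ[P] ℝ) ω := by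
    refine ae_all_iff.2 fun n => ?_
    filter_upwards [coeFn_sum_orliczSpace (Finset.Ico n (n + M n)) fun j => u (φ j),
      AEEqFun.coeFn_smul (M n : ℝ)⁻¹
        ((∑ j ∈ Finset.Ico n (n + M n), u (φ j) : orliczSpace P Φ.conj) : Ω →ₘ[P] ℝ)] with ω h1 h2
    rw [← h1, ← smul_eq_mul]
    exact h2
  refine (hCo.inter (isOrderClosed_dualBall r)) _ v (fun n => ?_) ?_
    ⟨ζ, hζ, fun n => ?_⟩
  · have hM' : (M n : ℝ) ≠ 0 := by exact_mod_cast (hM n).ne'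
    simp only [hv]
    rw [Finset.smul_sum]
    exact (hC.inter (convex_dualBall r)).sum_mem (fun _ _ => by positivity)
      (by simp [hM']) fun j _ => hu _
  · filter_upwards [hvcoe, hlim] with ω h1 h2
    simp_rw [h1]
    exact tendsto_window_average (h2.comp hφ.tendsto_atTop) hM
  · filter_upwards [hvcoe, hdom] with ω h1 h2
    rw [h1]
    exact h2 n

/-- An order closed set that does not contain `0` does not meet some dual ball around `0`. -/
theorem IsOrderClosed.exists_disjoint_dualBall [IsProbabilityMeasure P]
    {C : Set (orliczSpace P Φ.conj)} (hCo : IsOrderClosed C) (h0 : 0 ∉ C) :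
    ∃ r : ℝ, 0 < r ∧ ∀ ξ ∈ C, ξ ∉ dualBall P Φ r := by
  by_contra! h
  choose u huC hu using fun k : ℕ => h (4⁻¹ ^ k) (by positivity)
  have hm : ∀ ξ : Ω →ₘ[P] ℝ, Measurable ξ := fun ξ => ξ.stronglyMeasurable.measurable
  have hmod : ∀ k, ∫⁻ ω, ENNReal.ofReal (Φ.conj (2 ^ k * (u k : Ω →ₘ[P] ℝ) ω)) ∂P ≤ 2⁻¹ ^ k := by
    intro k
    have h1 := lintegral_conj_le_one_of_mem_dualBall (by positivity) (hu k)
    calc ∫⁻ ω, ENNReal.ofReal (Φ.conj (2 ^ k * (u k : Ω →ₘ[P] ℝ) ω)) ∂P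
        ≤ ∫⁻ ω, 2⁻¹ ^ k *
            ENNReal.ofReal (Φ.conj ((4⁻¹ ^ k)⁻¹ * (u k : Ω →ₘ[P] ℝ) ω)) ∂P := by
          refine lintegral_mono fun ω => ?_
          rw [show (2⁻¹ : ℝ≥0∞) = ENNReal.ofReal 2⁻¹ by
            rw [ENNReal.ofReal_inv_of_pos two_pos]; simp, ← ENNReal.ofReal_pow (by norm_num),
            ← ENNReal.ofReal_mul (by positivity)]
          refine ENNReal.ofReal_le_ofReal ?_
          have h2 : (2 : ℝ) ^ k * (u k : Ω →ₘ[P] ℝ) ω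
              = 2⁻¹ ^ k * ((4⁻¹ ^ k)⁻¹ * (u k : Ω →ₘ[P] ℝ) ω) := by
            rw [← mul_assoc, inv_pow 4, inv_inv, ← mul_pow]; norm_num
          rw [h2]
          exact Φ.conj.mul_le_mul (by positivity) (pow_le_one₀ (by norm_num) (by norm_num))
      _ ≤ 2⁻¹ ^ k := by
          rw [lintegral_const_mul' _ _ (by simp)]
          exact (mul_le_mul' le_rfl h1).trans_eq (mul_one _)
  obtain ⟨ζ, hζ, hdom⟩ := exists_dominating_of_tsum_ne_top (P := P) (Ψ := Φ.conj)
    (x := fun k ω => 2 ^ k * (u k : Ω →ₘ[P] ℝ) ω)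
    (fun k => ((hm _).const_mul _).aemeasurable)
    (ne_top_of_le_ne_top (by rw [tsum_inv_two_pow]; simp) (ENNReal.tsum_le_tsum hmod))
  have hdom' : ∀ᵐ ω ∂P, ∀ k, |(u k : Ω →ₘ[P] ℝ) ω| ≤ 2⁻¹ ^ k * ζ ω := by
    filter_upwards [hdom] with ω hω k
    have h1 := hω k
    rw [abs_mul, abs_of_pos (by positivity : (0 : ℝ) < 2 ^ k)] at h1
    rwa [inv_pow, ← div_eq_inv_mul, le_div_iff₀ (by positivity), mul_comm]
  refine h0 (hCo 0 u huC ?_ ⟨ζ, hζ, fun k => ?_⟩)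
  · filter_upwards [hdom', AEEqFun.coeFn_zero (α := Ω) (β := ℝ) (μ := P)] with ω h1 h2
    rw [Submodule.coe_zero, h2]
    refine squeeze_zero_norm h1 ?_
    simpa using (tendsto_pow_atTop_nhds_zero_of_lt_one (r := (2⁻¹ : ℝ)) (by norm_num)
      (by norm_num)).mul_const (ζ ω)
  · filter_upwards [hdom'] with ω h1
    have h2 : 0 ≤ ζ ω := by simpa using (abs_nonneg _).trans (h1 0)
    exact (h1 k).trans (mul_le_of_le_one_left h2 (pow_le_one₀ (by norm_num) (by norm_num)))

/-- The compactness step of the Krein–Šmulian argument: if a dual ball of radius `R` does not meet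
`C`, then finitely many constraints from the ball of radius `1 / R` of `L_Φ` keep any given larger
dual ball away from `C`. -/
theorem IsOrderClosed.exists_finset_disjoint [IsProbabilityMeasure P] (hΦ : Φ.Delta2)
    {C : Set (orliczSpace P Φ.conj)} (hC : Convex ℝ C) (hCo : IsOrderClosed C) {R R' : ℝ}
    (hR : 0 < R) (hR' : 0 < R') (hdisj : ∀ ξ ∈ C, ξ ∉ dualBall P Φ R) :
    ∃ F : Finset (orliczSpace P Φ), (∀ x ∈ F, R • x ∈ modularBall P Φ) ∧
      ∀ ξ ∈ C, ξ ∈ dualBall P Φ R' → ∃ x ∈ F, 1 < |orliczPairing P Φ ξ x| := by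
  classical
  by_contra! hcon
  let α := {x : orliczSpace P Φ // R • x ∈ modularBall P Φ}
  let C' : Finset α → Set (orliczSpace P Φ.conj) := fun F =>
    C ∩ ⋂ x : F, {ξ | |orliczPairing P Φ ξ (x : α)| ≤ 1}
  have hC' : ∀ F, Convex ℝ (C' F) := fun F =>
    hC.inter (convex_iInter fun x => convex_abs_orliczPairing_le _ _)
  have hCo' : ∀ F, IsOrderClosed (C' F) := fun F =>
    hCo.inter (isOrderClosed_iInter fun x => isOrderClosed_abs_orliczPairing_le _ _)
  let D : Finset α → Set (Ω →ₘ[P] ℝ) := fun F =>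
    (orliczSpace P Φ.conj).subtype '' (C' F ∩ dualBall P Φ R')
  have key : ∃ ξ, ∀ F, ξ ∈ D F := by
    refine exists_forall_mem_of_convex_of_bounded (M := R' * (Φ 1 + 1)) ?_ ?_ ?_ ?_ ?_ ?_
    · rintro F G hFG _ ⟨x, ⟨⟨h1, h2⟩, h3⟩, rfl⟩
      exact ⟨x, ⟨⟨h1, mem_iInter.2 fun y => mem_iInter.1 h2 ⟨y, hFG y.2⟩⟩, h3⟩, rfl⟩
    · intro F
      obtain ⟨x, hxC, hxR, hx⟩ := hcon (F.image Subtype.val) (by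
        intro x hx
        obtain ⟨y, -, rfl⟩ := Finset.mem_image.1 hx
        exact y.2)
      exact ⟨x, x, ⟨⟨hxC, mem_iInter.2 fun y =>
        hx _ (Finset.mem_image_of_mem Subtype.val y.2)⟩, hxR⟩, rfl⟩
    · exact fun F => ((hC' F).inter (convex_dualBall R')).linear_image _
    · intro F u ξ hu hlim
      choose x hx hxu using hu
      obtain ⟨hξ, hξ'⟩ := (hCo' F).mem_of_tendsto_of_mem_dualBall hΦ (hC' F) hR' hx (ξ := ξ) (by
        filter_upwards [hlim] with ω hω
        refine hω.congr fun n => ?_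
        rw [← hxu n]; rfl)
      exact ⟨⟨ξ, hξ⟩, hξ', rfl⟩
    · rintro F _ ⟨x, ⟨-, hx⟩, rfl⟩
      exact (integral_abs_le_of_mem_dualBall hR' hx).1
    · rintro F _ ⟨x, ⟨-, hx⟩, rfl⟩
      exact (integral_abs_le_of_mem_dualBall hR' hx).2
  obtain ⟨ξ, hξ⟩ := key
  obtain ⟨x, ⟨⟨hxC, -⟩, -⟩, rfl⟩ := hξ ∅
  refine hdisj x hxC fun η hη => ?_
  have hmem : R • (R⁻¹ • η) ∈ modularBall P Φ := by
    rwa [smul_smul, mul_inv_cancel₀ hR.ne', one_smul]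
  obtain ⟨y, ⟨⟨-, hy⟩, -⟩, hyx⟩ := hξ {⟨R⁻¹ • η, hmem⟩}
  have hyx' : y = x := Subtype.ext hyx
  have h1 := mem_iInter.1 hy ⟨⟨R⁻¹ • η, hmem⟩, Finset.mem_singleton_self _⟩
  rw [hyx'] at h1
  have h2 : |orliczPairing P Φ x (R⁻¹ • η)| ≤ 1 := h1
  rwa [map_smul, smul_eq_mul, abs_mul, abs_of_pos (inv_pos.2 hR), inv_mul_le_iff₀ hR,
    mul_one] at h2

/-- **Krein–Šmulian for order closed sets.** An order closed convex subset of `L_{Φ*}` that does not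
contain `0` is strictly separated from `0` by an element of `L_Φ`. -/
theorem IsOrderClosed.exists_separating [IsProbabilityMeasure P] (hΦ : Φ.Delta2)
    {C : Set (orliczSpace P Φ.conj)} (hC : Convex ℝ C) (hCo : IsOrderClosed C) (h0 : 0 ∉ C) :
    ∃ (η : orliczSpace P Φ) (u : ℝ), 0 < u ∧ ∀ ξ ∈ C, u ≤ orliczPairing P Φ ξ η := by
  classical
  obtain ⟨r, hr, hCr⟩ := hCo.exists_disjoint_dualBall h0
  -- the constraints in `G` keep the dual ball of radius `r (n + 1)` away from `C`
  let Q : ℕ → Finset (orliczSpace P Φ) → Prop := fun n G =>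
    ∀ ξ ∈ C, ξ ∈ dualBall P Φ (r * (n + 1)) → ∃ x ∈ G, 1 < |orliczPairing P Φ ξ x|
  have hstep : ∀ n G, ∃ F : Finset (orliczSpace P Φ), Q n G →
      (∀ x ∈ F, (r * (n + 1)) • x ∈ modularBall P Φ) ∧ Q (n + 1) (G ∪ F) := by
    intro n G
    by_cases hQ : Q n G
    · let C' := C ∩ ⋂ x : G, {ξ | |orliczPairing P Φ ξ x| ≤ 1}
      have hC' : Convex ℝ C' := hC.inter (convex_iInter fun x => convex_abs_orliczPairing_le _ _)
      have hCo' : IsOrderClosed C' :=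
        hCo.inter (isOrderClosed_iInter fun x => isOrderClosed_abs_orliczPairing_le _ _)
      obtain ⟨F, hF1, hF2⟩ := hCo'.exists_finset_disjoint (R := r * (n + 1))
        (R' := r * ((n + 1 : ℕ) + 1)) hΦ hC' (by positivity) (by positivity) (by
          rintro ξ ⟨hξ, hξG⟩ hξb
          obtain ⟨x, hx, hx1⟩ := hQ ξ hξ hξb
          exact absurd (mem_iInter.1 hξG ⟨x, hx⟩) (not_le.2 hx1))
      refine ⟨F, fun _ => ⟨hF1, fun ξ hξ hξb => ?_⟩⟩
      by_cases hG : ∃ x ∈ G, 1 < |orliczPairing P Φ ξ x|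
      · obtain ⟨x, hx, hx1⟩ := hG
        exact ⟨x, Finset.mem_union_left _ hx, hx1⟩
      · push Not at hG
        obtain ⟨x, hx, hx1⟩ := hF2 ξ ⟨hξ, mem_iInter.2 fun x => hG x x.2⟩ hξb
        exact ⟨x, Finset.mem_union_right _ hx, hx1⟩
    · exact ⟨∅, fun h => absurd h hQ⟩
  choose F hF using hstep
  let G : ℕ → Finset (orliczSpace P Φ) := fun n => Nat.rec ∅ (fun n G => G ∪ F n G) n
  have hGs : ∀ n, G (n + 1) = G n ∪ F n (G n) := fun n => rfl
  have hQ : ∀ n, Q n (G n) := by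
    intro n
    induction n with
    | zero =>
      intro ξ hξ hb
      exact absurd (by simpa using hb) (hCr ξ hξ)
    | succ n ih => exact (hF n (G n) ih).2
  have hmemG : ∀ n, ∀ x ∈ G n, ∃ m, x ∈ F m (G m) := by
    intro n
    induction n with
    | zero => intro x hx; exact absurd hx (Finset.notMem_empty x)
    | succ n ih =>
      intro x hx
      rw [hGs, Finset.mem_union] at hx
      rcases hx with hx | hx
      · exact ih x hx
      · exact ⟨n, hx⟩
  let ι := Σ n : ℕ, F n (G n)
  have hball : ∀ i : ι, (r * (i.1 + 1)) • (i.2 : orliczSpace P Φ) ∈ modularBall P Φ := fun i =>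
    (hF i.1 (G i.1) (hQ i.1)).1 _ i.2.2
  let T : ι → orliczSpace P Φ.conj →ₗ[ℝ] ℝ := fun i =>
    (orliczPairing P Φ).flip (i.2 : orliczSpace P Φ)
  have hbdd : ∀ ξ : orliczSpace P Φ.conj, ∃ K : ℝ, 0 ≤ K ∧ ∀ η ∈ modularBall P Φ,
      |orliczPairing P Φ ξ η| ≤ K := fun ξ => by
    obtain ⟨K, hK0, hK⟩ := exists_integral_abs_mul_le ξ.2
    exact ⟨K, hK0, fun η hη => (abs_orliczPairing_le ξ η).trans (hK η hη)⟩
  have hnull : ∀ ξ, Tendsto (fun i => T i ξ) cofinite (𝓝 0) := by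
    intro ξ
    obtain ⟨K, hK0, hK⟩ := hbdd ξ
    rw [Metric.tendsto_nhds]
    intro ε hε
    obtain ⟨m, hm⟩ := exists_nat_gt (K / (r * ε))
    refine (((Finset.range m).sigma fun n =>
      (Finset.univ : Finset (F n (G n)))).finite_toSet).subset ?_
    intro i hi
    by_contra hmem
    refine hi ?_
    have him : m ≤ i.1 := by
      by_contra! hlt
      exact hmem (by simp [hlt])
    have hpos : 0 < r * ((i.1 : ℝ) + 1) := by positivity
    have h1 := hK _ (hball i)
    rw [map_smul, smul_eq_mul, abs_mul, abs_of_pos hpos] at h1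
    have h2 : K < r * ε * (i.1 + 1) := by
      rw [div_lt_iff₀ (by positivity)] at hm
      have : (m : ℝ) ≤ i.1 := by exact_mod_cast him
      have : (0 : ℝ) < r * ε := by positivity
      nlinarith
    show dist (T i ξ) 0 < ε
    rw [Real.dist_eq, sub_zero]
    have h3 : |T i ξ| * (r * ((i.1 : ℝ) + 1)) < ε * (r * ((i.1 : ℝ) + 1)) := by
      calc |T i ξ| * (r * ((i.1 : ℝ) + 1)) ≤ K := by rw [mul_comm]; exact h1
        _ < _ := by linarith
    exact lt_of_mul_lt_mul_right h3 hpos.le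
  obtain ⟨c, hc, u, hu, hcu⟩ := exists_summable_separating hC T hnull (by
    intro ξ hξ
    obtain ⟨K, hK0, hK⟩ := hbdd ξ
    obtain ⟨n, hn⟩ := exists_nat_ge (K / r)
    obtain ⟨x, hx, hx1⟩ := hQ n ξ hξ (fun η hη => (hK η hη).trans (by
      rw [div_le_iff₀ hr] at hn; nlinarith))
    obtain ⟨m, hm⟩ := hmemG n x hx
    exact ⟨⟨m, x, hm⟩, hx1⟩)
  have hz : ∀ i : ι, r • (i.2 : orliczSpace P Φ) ∈ modularBall P Φ := by
    intro i
    have hpos : 0 < (i.1 : ℝ) + 1 := by positivity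
    have h1 := smul_mem_modularBall (t := ((i.1 : ℝ) + 1)⁻¹) (by positivity)
      (inv_le_one_of_one_le₀ (by linarith [(Nat.cast_nonneg i.1 : (0 : ℝ) ≤ i.1)])) (hball i)
    rwa [smul_smul, show ((i.1 : ℝ) + 1)⁻¹ * (r * (i.1 + 1)) = r by field_simp] at h1
  obtain ⟨η, hη⟩ := exists_hasSum_orliczPairing (c := fun i => r⁻¹ * c i)
    (by simp_rw [abs_mul]; exact hc.mul_left _) hz
  refine ⟨η, u, hu, fun ξ hξ => ?_⟩
  obtain ⟨v, huv, hv⟩ := hcu ξ hξ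
  have h1 : HasSum (fun i => c i * T i ξ) (orliczPairing P Φ ξ η) := by
    refine (hη ξ).congr_fun fun i => ?_
    rw [map_smul, smul_eq_mul, ← mul_assoc, mul_right_comm _ (c i), inv_mul_cancel₀ hr.ne', one_mul]
    rfl
  rwa [h1.unique hv]

end KreinSmulian

/-! ### Mackey convergence of dominated sequences -/

section Mackey

variable {Ω : Type*} [MeasurableSpace Ω] {P : Measure Ω} {Φ : YoungFunction}

theorem continuous_orliczPairing_flip (ξ : orliczSpace P Φ.conj) :
    @Continuous _ _ (weakTopology (orliczPairing P Φ).flip) _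
      (fun η => orliczPairing P Φ ξ η) :=
  WeakBilin.eval_continuous (orliczPairing P Φ).flip ξ

/-- A series in `L_{Φ*}` that is absolutely dominated by an element of the space has a sum, which
the pairing respects. -/
theorem exists_tendsto_sum_orliczPairing {f : ℕ → orliczSpace P Φ.conj} {ζ : Ω →ₘ[P] ℝ}
    (hζ : ζ ∈ orliczSpace P Φ.conj)
    (hf : ∀ᵐ ω ∂P, ∀ s : Finset ℕ, ∑ k ∈ s, |(f k : Ω →ₘ[P] ℝ) ω| ≤ ζ ω) :
    ∃ g : orliczSpace P Φ.conj, ∀ η : orliczSpace P Φ,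
      Tendsto (fun n => ∑ k ∈ Finset.range n, orliczPairing P Φ (f k) η) atTop
        (𝓝 (orliczPairing P Φ g η)) := by
  have hm : Measurable fun ω => ∑' k, (f k : Ω →ₘ[P] ℝ) ω :=
    Measurable.tsum fun k => (f k : Ω →ₘ[P] ℝ).stronglyMeasurable.measurable
  have hcoe := AEEqFun.coeFn_mk (μ := P) _ hm.aestronglyMeasurable
  have hlim : ∀ᵐ ω ∂P, Tendsto (fun n => ∑ k ∈ Finset.range n, (f k : Ω →ₘ[P] ℝ) ω) atTop
      (𝓝 (∑' k, (f k : Ω →ₘ[P] ℝ) ω)) := by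
    filter_upwards [hf] with ω hω
    have : Summable fun k => (f k : Ω →ₘ[P] ℝ) ω :=
      (summable_of_sum_le (fun k => abs_nonneg _) hω).of_abs
    exact this.hasSum.tendsto_sum_nat
  have hbd : ∀ᵐ ω ∂P, ∀ n, |∑ k ∈ Finset.range n, (f k : Ω →ₘ[P] ℝ) ω| ≤ ζ ω := by
    filter_upwards [hf] with ω hω n
    exact (Finset.abs_sum_le_sum_abs _ _).trans (hω _)
  have hmem : AEEqFun.mk _ hm.aestronglyMeasurable ∈ orliczSpace P Φ.conj := by
    refine mem_orliczSpace_of_abs_le hζ ?_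
    filter_upwards [hcoe, hlim, hbd] with ω h1 h2 h3
    rw [h1]
    exact le_of_tendsto h2.abs (Eventually.of_forall h3)
  refine ⟨⟨_, hmem⟩, fun η => ?_⟩
  have h := tendsto_orliczPairing (ξ := ⟨_, hmem⟩)
    (u := fun n => ∑ k ∈ Finset.range n, f k) hζ
    (fun n => by
      filter_upwards [coeFn_sum_orliczSpace (Finset.range n) f, hbd] with ω h1 h2
      rw [h1]
      exact h2 n) (by
      filter_upwards [ae_all_iff.2 fun n => coeFn_sum_orliczSpace (Finset.range n) f, hlim, hcoe]
        with ω h1 h2 h3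
      simp_rw [h1]
      rw [h3]
      exact h2) η
  simpa [map_sum, LinearMap.sum_apply] using h

/-- The terms of an absolutely dominated series in `L_{Φ*}` cannot stay away from zero on a weakly
compact subset `A` of `L_Φ`. This is a gliding hump argument. By compactness, a subsequence of the
`η k` converges on all terms `f i` to some `η₀ ∈ A`. If the pairings were bounded below, a sum `g`
of well separated terms would keep `⟨g, η k - η₀⟩` away from zero along a subsequence. But compactness
for one more functional gives a further subsequence along which `⟨g, η k⟩` converges to `⟨g, η₁⟩`,
where `η₁ ∈ A` agrees with `η₀` on all terms and so on `g`. -/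
theorem exists_abs_orliczPairing_lt_of_sum_le {A : Set (orliczSpace P Φ)}
    (hA : @IsCompact _ (weakTopology (orliczPairing P Φ).flip) A)
    {f : ℕ → orliczSpace P Φ.conj} {ζ : Ω →ₘ[P] ℝ} (hζ : ζ ∈ orliczSpace P Φ.conj)
    (hf : ∀ᵐ ω ∂P, ∀ s : Finset ℕ, ∑ k ∈ s, |(f k : Ω →ₘ[P] ℝ) ω| ≤ ζ ω)
    {η : ℕ → orliczSpace P Φ} (hη : ∀ k, η k ∈ A) {ε : ℝ} (hε : 0 < ε) :
    ∃ k, |orliczPairing P Φ (f k) (η k)| < ε := by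
  by_contra! h
  let _ : TopologicalSpace (orliczSpace P Φ) := weakTopology (orliczPairing P Φ).flip
  have hT : Continuous fun (x : orliczSpace P Φ) (i : ℕ) => orliczPairing P Φ (f i) x :=
    continuous_pi fun i => continuous_orliczPairing_flip (f i)
  obtain ⟨_, ⟨η₀, -, rfl⟩, φ, hφ, hφlim⟩ :=
    (hA.image hT).tendsto_subseq (x := fun k i => orliczPairing P Φ (f i) (η k))
      fun k => ⟨η k, hη k, rfl⟩
  have hφlim' : ∀ i, Tendsto (fun k => orliczPairing P Φ (f i) (η (φ k))) atTop
      (𝓝 (orliczPairing P Φ (f i) η₀)) := fun i => (tendsto_pi_nhds.1 hφlim) i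
  have hrow : ∀ x : orliczSpace P Φ, Tendsto (fun i => orliczPairing P Φ (f i) x) atTop (𝓝 0) := by
    intro x
    have h1 := tendsto_orliczPairing (ξ := 0) (u := f) hζ (fun n => by
      filter_upwards [hf] with ω hω
      simpa using hω {n}) (by
      filter_upwards [hf, AEEqFun.coeFn_zero (α := Ω) (β := ℝ) (μ := P)] with ω h1 h2
      rw [Submodule.coe_zero, h2]
      exact ((summable_of_sum_le (fun k => abs_nonneg _) h1).of_abs).tendsto_atTop_zero) x
    simpa using h1
  set a : ℕ → ℕ → ℝ := fun i j => orliczPairing P Φ (f (φ i)) (η (φ j) - η₀) with ha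
  have ha1 : ∀ i, Tendsto (fun j => a i j) atTop (𝓝 0) := fun i => by
    simpa [ha] using (hφlim' (φ i)).sub_const (orliczPairing P Φ (f (φ i)) η₀)
  have ha2 : ∀ j, Tendsto (fun i => a i j) atTop (𝓝 0) := fun j =>
    (hrow _).comp hφ.tendsto_atTop
  have hpos : ∀ l : ℕ, 0 < ε / 8 * 2⁻¹ ^ l := fun l => by positivity
  have hsmall : ∀ {b : ℕ → ℝ}, Tendsto b atTop (𝓝 0) → ∀ {δ : ℝ}, 0 < δ →
      ∀ᶠ k in atTop, |b k| ≤ δ := fun hb δ hδ => by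
    have h1 := hb.abs
    rw [abs_zero] at h1
    exact h1.eventually_le_const hδ
  obtain ⟨ψ, hψ, hψ1, hψ2⟩ := exists_strictMono_forall_lt
    (p := fun i k l => |a i k| ≤ ε / 8 * 2⁻¹ ^ l ∧ |a k i| ≤ ε / 8 * 2⁻¹ ^ l)
    (q := fun k _ => |orliczPairing P Φ (f (φ k)) η₀| ≤ ε / 4)
    (fun i l => (hsmall (ha1 i) (hpos l)).and (hsmall (ha2 i) (hpos l)))
    (fun l => hsmall ((hrow η₀).comp hφ.tendsto_atTop) (by positivity))
  have hoff : ∀ k l, l ≠ k → |a (ψ l) (ψ k)| ≤ ε / 8 * 2⁻¹ ^ l := by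
    intro k l hlk
    rcases lt_or_gt_of_ne hlk with hlt | hgt
    · refine (hψ1 l k hlt).1.trans (mul_le_mul_of_nonneg_left ?_ (by positivity))
      exact pow_le_pow_of_le_one (by norm_num) (by norm_num) hlt.le
    · exact (hψ1 k l hgt).2
  obtain ⟨g, hg⟩ := exists_tendsto_sum_orliczPairing (f := fun l => f (φ (ψ l))) hζ (by
    filter_upwards [hf] with ω hω s
    have h1 := hω (s.map ⟨fun l => φ (ψ l), (hφ.comp hψ).injective⟩)
    rwa [Finset.sum_map] at h1)
  -- the pairing of the subseries with the `k`-th difference is dominated by its `k`-th term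
  have hlow : ∀ k, ε / 2 ≤ |orliczPairing P Φ g (η (φ (ψ k)) - η₀)| := by
    intro k
    have hdiag : ε - ε / 4 ≤ |a (ψ k) (ψ k)| := by
      have h1 := h (φ (ψ k))
      have h2 := hψ2 k
      simp only [ha, map_sub]
      linarith [abs_sub_abs_le_abs_sub (orliczPairing P Φ (f (φ (ψ k))) (η (φ (ψ k))))
        (orliczPairing P Φ (f (φ (ψ k))) η₀)]
    refine ge_of_tendsto (hg (η (φ (ψ k)) - η₀)).abs ?_
    filter_upwards [eventually_gt_atTop k] with n hn
    have hmem : k ∈ Finset.range n := Finset.mem_range.2 hn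
    rw [← Finset.add_sum_erase _ _ hmem]
    have hrest : |∑ l ∈ (Finset.range n).erase k, a (ψ l) (ψ k)| ≤ ε / 4 := by
      calc |∑ l ∈ (Finset.range n).erase k, a (ψ l) (ψ k)|
          ≤ ∑ l ∈ (Finset.range n).erase k, |a (ψ l) (ψ k)| := Finset.abs_sum_le_sum_abs _ _
        _ ≤ ∑ l ∈ (Finset.range n).erase k, ε / 8 * 2⁻¹ ^ l :=
            Finset.sum_le_sum fun l hl => hoff k l (Finset.ne_of_mem_erase hl)
        _ = ε / 8 * ∑ l ∈ (Finset.range n).erase k, (2⁻¹ : ℝ) ^ l := by rw [Finset.mul_sum]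
        _ ≤ ε / 8 * 2 := by
            refine mul_le_mul_of_nonneg_left ?_ (by positivity)
            have h2 := summable_geometric_two.sum_le_tsum ((Finset.range n).erase k)
              fun l _ => by positivity
            rw [tsum_geometric_two] at h2
            simpa [one_div] using h2
        _ = ε / 4 := by ring
    have h3 := abs_sub_abs_le_abs_sub (a (ψ k) (ψ k))
      (-∑ l ∈ (Finset.range n).erase k, a (ψ l) (ψ k))
    rw [abs_neg, sub_neg_eq_add] at h3
    change ε / 2 ≤ |a (ψ k) (ψ k) + ∑ l ∈ (Finset.range n).erase k, a (ψ l) (ψ k)|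
    linarith
  have hT' : Continuous fun x : orliczSpace P Φ =>
      ((fun i : ℕ => orliczPairing P Φ (f i) x), orliczPairing P Φ g x) :=
    hT.prodMk (continuous_orliczPairing_flip g)
  obtain ⟨_, ⟨η₁, -, rfl⟩, χ, hχ, hχlim⟩ := (hA.image hT').tendsto_subseq
    (x := fun k => ((fun i => orliczPairing P Φ (f i) (η (φ (ψ k)))),
      orliczPairing P Φ g (η (φ (ψ k))))) fun k => ⟨η (φ (ψ k)), hη _, rfl⟩
  have h1 : ∀ i, orliczPairing P Φ (f i) η₁ = orliczPairing P Φ (f i) η₀ := fun i =>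
    tendsto_nhds_unique (tendsto_pi_nhds.1 ((continuous_fst.tendsto _).comp hχlim) i)
      ((hφlim' i).comp (hψ.comp hχ).tendsto_atTop)
  have h2 : orliczPairing P Φ g η₁ = orliczPairing P Φ g η₀ :=
    tendsto_nhds_unique (hg η₁) (by simpa only [h1] using hg η₀)
  have h3 : Tendsto (fun k => |orliczPairing P Φ g (η (φ (ψ (χ k))) - η₀)|) atTop (𝓝 0) := by
    have h4 : Tendsto (fun k => orliczPairing P Φ g (η (φ (ψ (χ k))))) atTop
        (𝓝 (orliczPairing P Φ g η₁)) := (continuous_snd.tendsto _).comp hχlim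
    rw [h2] at h4
    simpa using (h4.sub_const (orliczPairing P Φ g η₀)).abs
  have h5 := ge_of_tendsto h3 (Eventually.of_forall fun k => hlow (χ k))
  linarith

/-- Dominated almost sure convergence to zero is uniform on a weakly compact subset of `L_Φ`, in
sequential form. Along a subsequence, the terms are absolutely summable with dominated sum after
the removal of the large values that overlap with those of later terms, and the removed parts have
small pairing with the respective `η`. -/
theorem exists_abs_orliczPairing_lt_of_tendsto_zero [IsProbabilityMeasure P]
    {A : Set (orliczSpace P Φ)}
    (hA : @IsCompact _ (weakTopology (orliczPairing P Φ).flip) A)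
    {x : ℕ → orliczSpace P Φ.conj} {ζ : Ω →ₘ[P] ℝ} (hζ : ζ ∈ orliczSpace P Φ.conj)
    (hx : ∀ᵐ ω ∂P, ∀ n, |(x n : Ω →ₘ[P] ℝ) ω| ≤ ζ ω)
    (h0 : ∀ᵐ ω ∂P, Tendsto (fun n => (x n : Ω →ₘ[P] ℝ) ω) atTop (𝓝 0))
    {η : ℕ → orliczSpace P Φ} (hη : ∀ k, η k ∈ A) {ε : ℝ} (hε : 0 < ε) :
    ∃ k, |orliczPairing P Φ (x k) (η k)| < ε := by
  by_contra! h
  have hxm : ∀ k, Measurable (x k : Ω →ₘ[P] ℝ) := fun k =>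
    (x k : Ω →ₘ[P] ℝ).stronglyMeasurable.measurable
  have hint : ∀ i, Integrable (fun ω => |(η i : Ω →ₘ[P] ℝ) ω * ζ ω|) P := fun i =>
    (integrable_mul_of_mem_orliczSpace P Φ (η i).2 hζ).abs
  have hpow : ∀ l : ℕ, (0 : ℝ≥0∞) < 2⁻¹ ^ l * 2⁻¹ ^ l := fun l =>
    ENNReal.mul_pos (pow_ne_zero _ (by simp)) (pow_ne_zero _ (by simp))
  obtain ⟨ψ, hψ, hψ1, -⟩ := exists_strictMono_forall_lt
    (p := fun i k l => ∫⁻ ω in {ω | (2⁻¹ : ℝ) ^ l < |(x k : Ω →ₘ[P] ℝ) ω|},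
      ENNReal.ofReal |(η i : Ω →ₘ[P] ℝ) ω * ζ ω| ∂P ≤ 2⁻¹ ^ l * 2⁻¹ ^ l)
    (q := fun _ _ => True)
    (fun i l => (tendsto_setLIntegral_abs_gt hxm h0 (hint i).aemeasurable.ennreal_ofReal
      (by
        rw [← ofReal_integral_eq_lintegral_ofReal (hint i)
          (Eventually.of_forall fun ω => abs_nonneg _)]
        exact ENNReal.ofReal_ne_top) (by positivity)).eventually_le_const (hpow l))
    (fun l => Eventually.of_forall fun _ => trivial)
  set S : ℕ → Set Ω := fun l => {ω | (2⁻¹ : ℝ) ^ l < |(x (ψ l) : Ω →ₘ[P] ℝ) ω|} with hS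
  have hSm : ∀ l, MeasurableSet (S l) := fun l => measurableSet_lt measurable_const (hxm _).abs
  set B : ℕ → Set Ω := fun j => ⋃ m, S (j + 1 + m) with hB
  have hBm : ∀ j, MeasurableSet (B j) := fun j => MeasurableSet.iUnion fun m => hSm _
  -- remove from each term the large values that overlap with those of later terms
  set F : ℕ → Ω → ℝ := fun j => (S j ∩ B j)ᶜ.indicator (x (ψ j) : Ω →ₘ[P] ℝ) with hF
  have hFm : ∀ j, AEStronglyMeasurable (F j) P := fun j =>
    ((hxm _).indicator ((hSm j).inter (hBm j)).compl).aestronglyMeasurable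
  have hcoe : ∀ᵐ ω ∂P, ∀ j, (AEEqFun.mk (F j) (hFm j) : Ω →ₘ[P] ℝ) ω = F j ω :=
    ae_all_iff.2 fun j => AEEqFun.coeFn_mk _ (hFm j)
  have hFle : ∀ j ω, |F j ω| ≤ |(x (ψ j) : Ω →ₘ[P] ℝ) ω| := by
    intro j ω
    simp only [hF]
    by_cases hω : ω ∈ (S j ∩ B j)ᶜ
    · rw [indicator_of_mem hω]
    · rw [indicator_of_notMem hω, abs_zero]; exact abs_nonneg _
  have hmem : ∀ j, AEEqFun.mk (F j) (hFm j) ∈ orliczSpace P Φ.conj := fun j => by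
    refine mem_orliczSpace_of_abs_le hζ ?_
    filter_upwards [hcoe, hx] with ω h1 h2
    rw [h1]
    exact (hFle j ω).trans (h2 _)
  let f : ℕ → orliczSpace P Φ.conj := fun j => ⟨_, hmem j⟩
  have htwo : AEEqFun.const Ω (2 : ℝ) ∈ orliczSpace P Φ.conj := by
    refine mem_orliczSpace_of_bounded (C := 2) ?_
    filter_upwards [AEEqFun.coeFn_const Ω (2 : ℝ)] with ω h
    simp [h]
  have hsum : ∀ᵐ ω ∂P, ∀ s : Finset ℕ, ∑ k ∈ s, |(f k : Ω →ₘ[P] ℝ) ω|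
      ≤ (AEEqFun.const Ω (2 : ℝ) + ζ : Ω →ₘ[P] ℝ) ω := by
    filter_upwards [hcoe, hx, AEEqFun.coeFn_const Ω (2 : ℝ),
      AEEqFun.coeFn_add (AEEqFun.const Ω (2 : ℝ)) ζ] with ω h1 h2 h3 h4 s
    rw [h4, Pi.add_apply, h3, Function.const_apply]
    have hζ0 : 0 ≤ ζ ω := (abs_nonneg _).trans (h2 0)
    have hpt : ∀ k, |(f k : Ω →ₘ[P] ℝ) ω| ≤ 2⁻¹ ^ k + (S k \ B k).indicator (fun _ => ζ ω) ω := by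
      intro k
      have h5 : (f k : Ω →ₘ[P] ℝ) ω = F k ω := h1 k
      rw [h5]
      have hp : (0 : ℝ) ≤ 2⁻¹ ^ k := by positivity
      by_cases hs : ω ∈ S k
      · by_cases hb : ω ∈ B k
        · have : F k ω = 0 := indicator_of_notMem (fun hn : ω ∈ (S k ∩ B k)ᶜ => hn ⟨hs, hb⟩) _
          rw [this, abs_zero, indicator_of_notMem (fun hn => hn.2 hb)]
          linarith
        · rw [indicator_of_mem (show ω ∈ S k \ B k from ⟨hs, hb⟩)]
          linarith [(hFle k ω).trans (h2 _)]
      · rw [indicator_of_notMem (fun hn => hs hn.1), add_zero]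
        exact (hFle k ω).trans (not_lt.1 hs)
    refine (Finset.sum_le_sum fun k _ => hpt k).trans ?_
    rw [Finset.sum_add_distrib]
    refine add_le_add ?_ ?_
    · have h2 := summable_geometric_two.sum_le_tsum s fun l _ => by positivity
      rw [tsum_geometric_two] at h2
      simpa [one_div] using h2
    · by_cases hz : ∀ k ∈ s, ω ∉ S k \ B k
      · rw [Finset.sum_eq_zero fun k hk => indicator_of_notMem (hz k hk) _]
        exact hζ0
      · push Not at hz
        obtain ⟨k, hk, hωk⟩ := hz
        rw [Finset.sum_eq_single_of_mem k hk, indicator_of_mem hωk]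
        intro l _ hlk
        refine indicator_of_notMem (fun hωl => ?_) _
        have hlast : ∀ i j, i < j → ω ∈ S j → ω ∈ B i := fun i j hij hj =>
          mem_iUnion.2 ⟨j - (i + 1), by rwa [show i + 1 + (j - (i + 1)) = j by omega]⟩
        rcases lt_or_gt_of_ne hlk with h | h
        · exact hωl.2 (hlast l k h hωk.1)
        · exact hωk.2 (hlast k l h hωl.1)
  have hdiff : ∀ j, |orliczPairing P Φ (x (ψ j)) (η (ψ j)) - orliczPairing P Φ (f j) (η (ψ j))|
      ≤ 2⁻¹ ^ j * 2 := by
    intro j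
    rw [← LinearMap.sub_apply, ← map_sub]
    refine (abs_orliczPairing_le _ _).trans ?_
    have hi : Integrable (fun ω => |(η (ψ j) : Ω →ₘ[P] ℝ) ω *
        ((x (ψ j) - f j : orliczSpace P Φ.conj) : Ω →ₘ[P] ℝ) ω|) P :=
      (integrable_mul_of_mem_orliczSpace P Φ (η (ψ j)).2 (x (ψ j) - f j).2).abs
    rw [← ENNReal.ofReal_le_ofReal_iff (by positivity),
      ofReal_integral_eq_lintegral_ofReal hi (Eventually.of_forall fun ω => abs_nonneg _)]
    calc ∫⁻ ω, ENNReal.ofReal |(η (ψ j) : Ω →ₘ[P] ℝ) ω *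
          ((x (ψ j) - f j : orliczSpace P Φ.conj) : Ω →ₘ[P] ℝ) ω| ∂P
        ≤ ∫⁻ ω, (B j).indicator
            (fun ω => ENNReal.ofReal |(η (ψ j) : Ω →ₘ[P] ℝ) ω * ζ ω|) ω ∂P := by
          refine lintegral_mono_ae ?_
          filter_upwards [hcoe, hx, AEEqFun.coeFn_sub (x (ψ j) : Ω →ₘ[P] ℝ)
            (f j : Ω →ₘ[P] ℝ)] with ω h1 h2 h3
          have h4 : ((x (ψ j) - f j : orliczSpace P Φ.conj) : Ω →ₘ[P] ℝ) ω
              = (x (ψ j) : Ω →ₘ[P] ℝ) ω - F j ω := by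
            rw [← h1 j]; exact h3
          rw [h4]
          by_cases hω : ω ∈ S j ∩ B j
          · have h5 : F j ω = 0 := indicator_of_notMem (fun hn : ω ∈ (S j ∩ B j)ᶜ => hn hω) _
            rw [indicator_of_mem hω.2, h5, sub_zero, abs_mul, abs_mul]
            exact ENNReal.ofReal_le_ofReal (mul_le_mul_of_nonneg_left
              ((h2 _).trans (le_abs_self _)) (abs_nonneg _))
          · have h5 : F j ω = (x (ψ j) : Ω →ₘ[P] ℝ) ω := indicator_of_mem hω _
            simp [h5]
      _ ≤ ∑' m, ∫⁻ ω in S (j + 1 + m), ENNReal.ofReal |(η (ψ j) : Ω →ₘ[P] ℝ) ω * ζ ω| ∂P := by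
          rw [lintegral_indicator (hBm j)]
          exact lintegral_iUnion_le _ _
      _ ≤ ∑' m : ℕ, 2⁻¹ ^ j * 2⁻¹ ^ m := by
          refine ENNReal.tsum_le_tsum fun m => (hψ1 j (j + 1 + m) (by omega)).trans ?_
          refine mul_le_mul' ?_ ?_ <;>
            exact pow_le_pow_right_of_le_one' (ENNReal.inv_le_one.2 one_le_two) (by omega)
      _ = ENNReal.ofReal (2⁻¹ ^ j * 2) := by
          rw [ENNReal.tsum_mul_left, tsum_inv_two_pow, ENNReal.ofReal_mul (by positivity),
            ENNReal.ofReal_pow (by norm_num), ENNReal.ofReal_inv_of_pos two_pos]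
          simp
  have hto : Tendsto (fun j : ℕ => (2⁻¹ : ℝ) ^ j * 2) atTop (𝓝 0) := by
    simpa using (tendsto_pow_atTop_nhds_zero_of_lt_one (r := (2⁻¹ : ℝ)) (by norm_num)
      (by norm_num)).mul_const 2
  obtain ⟨n, hn⟩ := (hto.eventually_le_const (half_pos hε)).exists_forall_of_atTop
  have hsum' : ∀ᵐ ω ∂P, ∀ s : Finset ℕ, ∑ k ∈ s, |(f (n + k) : Ω →ₘ[P] ℝ) ω|
      ≤ (AEEqFun.const Ω (2 : ℝ) + ζ : Ω →ₘ[P] ℝ) ω := by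
    filter_upwards [hsum] with ω hω s
    have h1 := hω (s.map (addLeftEmbedding n))
    rwa [Finset.sum_map] at h1
  obtain ⟨k, hk⟩ := exists_abs_orliczPairing_lt_of_sum_le hA (Submodule.add_mem _ htwo hζ)
    (f := fun k => f (n + k)) hsum' (η := fun k => η (ψ (n + k))) (fun k => hη _) (half_pos hε)
  have h1 := h (ψ (n + k))
  have h2 := (hdiff (n + k)).trans (hn (n + k) (by omega))
  have h3 := abs_sub_abs_le_abs_sub (orliczPairing P Φ (x (ψ (n + k))) (η (ψ (n + k))))
    (orliczPairing P Φ (f (n + k)) (η (ψ (n + k))))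
  linarith

/-- Dominated almost surely convergent sequences in `L_{Φ*}` converge in the Mackey topology. -/
theorem tendsto_mackeyTopology [IsProbabilityMeasure P] {ξ : orliczSpace P Φ.conj}
    {u : ℕ → orliczSpace P Φ.conj} {ζ : Ω →ₘ[P] ℝ} (hζ : ζ ∈ orliczSpace P Φ.conj)
    (hb : ∀ n, ∀ᵐ ω ∂P, |(u n : Ω →ₘ[P] ℝ) ω| ≤ ζ ω)
    (hlim : ∀ᵐ ω ∂P, Tendsto (fun n => (u n : Ω →ₘ[P] ℝ) ω) atTop (𝓝 ((ξ : Ω →ₘ[P] ℝ) ω))) :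
    Tendsto u atTop (@nhds _ (mackeyTopology (orliczPairing P Φ)) ξ) := by
  rw [nhds_induced, tendsto_comap_iff, UniformOnFun.tendsto_iff_tendstoUniformlyOn]
  rintro A ⟨-, -, hA⟩
  rw [Metric.tendstoUniformlyOn_iff]
  by_contra! hcon
  obtain ⟨ε, hε, hfreq⟩ := hcon
  obtain ⟨φ, hφ, hφ'⟩ := extraction_of_frequently_atTop (not_eventually.1 hfreq)
  push Not at hφ'
  choose η hη hdist using hφ'
  have hb' : ∀ᵐ ω ∂P, ∀ n, |(u n : Ω →ₘ[P] ℝ) ω| ≤ ζ ω := ae_all_iff.2 hb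
  have hdom : ∀ᵐ ω ∂P, ∀ n, |((u (φ n) - ξ : orliczSpace P Φ.conj) : Ω →ₘ[P] ℝ) ω|
      ≤ ((2 : ℝ) • ζ : Ω →ₘ[P] ℝ) ω := by
    filter_upwards [hb', hlim, AEEqFun.coeFn_smul (2 : ℝ) ζ, ae_all_iff.2 fun n =>
      AEEqFun.coeFn_sub (u (φ n) : Ω →ₘ[P] ℝ) (ξ : Ω →ₘ[P] ℝ)] with ω h1 h2 h3 h4 n
    have h5 : |(ξ : Ω →ₘ[P] ℝ) ω| ≤ ζ ω := le_of_tendsto h2.abs (Eventually.of_forall h1)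
    rw [h3, Submodule.coe_sub, h4, Pi.sub_apply, Pi.smul_apply, smul_eq_mul, two_mul]
    exact (abs_sub _ _).trans (add_le_add (h1 _) h5)
  have hnull : ∀ᵐ ω ∂P, Tendsto
      (fun n => ((u (φ n) - ξ : orliczSpace P Φ.conj) : Ω →ₘ[P] ℝ) ω) atTop (𝓝 0) := by
    filter_upwards [hlim, ae_all_iff.2 fun n =>
      AEEqFun.coeFn_sub (u (φ n) : Ω →ₘ[P] ℝ) (ξ : Ω →ₘ[P] ℝ)] with ω h2 h4
    simp_rw [Submodule.coe_sub, h4, Pi.sub_apply]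
    simpa using (h2.comp hφ.tendsto_atTop).sub_const ((ξ : Ω →ₘ[P] ℝ) ω)
  obtain ⟨k, hk⟩ := exists_abs_orliczPairing_lt_of_tendsto_zero hA
    (Submodule.smul_mem _ _ hζ) hdom hnull hη hε
  have h1 := hdist k
  rw [dist_comm, Real.dist_eq] at h1
  rw [map_sub, LinearMap.sub_apply] at hk
  exact absurd hk (not_lt.2 h1)

end Mackey

/-! ### Convex duality and order lower semicontinuity -/

section DualPair

variable {E F : Type*} [AddCommGroup E] [Module ℝ E] [AddCommGroup F] [Module ℝ F]

theorem IsProperConvex.convex_epigraph {f : E → EReal} (hf : IsProperConvex f) :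
    Convex ℝ {p : E × ℝ | f p.1 ≤ (p.2 : EReal)} := by
  refine convex_iff_forall_pos.2 ?_
  rintro ⟨x, s⟩ hx ⟨y, t⟩ hy a b ha hb hab
  refine (hf.convex x y a b ha hb hab).trans ?_
  have h1 : (a : EReal) * f x ≤ (a : EReal) * (s : EReal) :=
    mul_le_mul_of_nonneg_left hx (by exact_mod_cast ha.le)
  have h2 : (b : EReal) * f y ≤ (b : EReal) * (t : EReal) :=
    mul_le_mul_of_nonneg_left hy (by exact_mod_cast hb.le)
  refine (add_le_add h1 h2).trans_eq ?_
  simp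

theorem IsProperConvex.convex_sublevel {f : E → EReal} (hf : IsProperConvex f) (c : ℝ) :
    Convex ℝ {x | f x ≤ (c : EReal)} := by
  refine convex_iff_forall_pos.2 ?_
  intro x hx y hy a b ha hb hab
  have := convex_iff_forall_pos.1 hf.convex_epigraph (x := (x, c)) hx (y := (y, c)) hy ha hb hab
  simpa [← add_mul, hab] using this

/-- Separation of a point below the graph from the epigraph. The functional on the product is split
into its part on `E`, which is represented by an element of `F`, and its slope `s` in the vertical
direction. -/
theorem IsProperConvex.exists_separating_epigraph (B : E →ₗ[ℝ] F →ₗ[ℝ] ℝ) {f : E → EReal}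
    (hf : IsProperConvex f) (hlsc : @LowerSemicontinuous _ _ (weakTopology B) _ f) {x₀ : E} {a : ℝ}
    (ha : (a : EReal) < f x₀) :
    ∃ (y : F) (s u : ℝ), 0 ≤ s ∧ B x₀ y + s * a < u ∧
      ∀ (x : E) (t : ℝ), f x ≤ (t : EReal) → u < B x y + s * t := by
  let g : WeakBilin B → EReal := f
  have hg : LowerSemicontinuous g := hlsc
  have hclosed : IsClosed {p : WeakBilin B × ℝ | g p.1 ≤ (p.2 : EReal)} :=
    hg.isClosed_epigraph.preimage
      (continuous_fst.prodMk (continuous_coe_real_ereal.comp continuous_snd))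
  have hconv : Convex ℝ {p : WeakBilin B × ℝ | g p.1 ≤ (p.2 : EReal)} := hf.convex_epigraph
  obtain ⟨φ, u, h1, h2⟩ := geometric_hahn_banach_point_closed (E := WeakBilin B × ℝ) (x := (x₀, a))
    hconv hclosed (not_le.2 ha)
  obtain ⟨y, hy⟩ := LinearMap.dualEmbedding_surjective B
    (φ.comp (ContinuousLinearMap.inl ℝ (WeakBilin B) ℝ))
  have hφ : ∀ (x : WeakBilin B) (t : ℝ), φ (x, t) = B x y + φ (0, 1) * t := by
    intro x t
    have h3 : B x y = φ (x, 0) := DFunLike.congr_fun hy x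
    have h4 : (x, t) = (x, (0 : ℝ)) + t • ((0 : WeakBilin B), (1 : ℝ)) := by
      ext <;> simp
    rw [h4, map_add, map_smul, h3, smul_eq_mul, mul_comm]
  have h2' : ∀ (x : E) (t : ℝ), f x ≤ (t : EReal) → u < B x y + φ (0, 1) * t := fun x t hxt =>
    (h2 (x, t) hxt).trans_eq (hφ x t)
  refine ⟨y, φ (0, 1), u, ?_, (hφ x₀ a).symm.trans_lt h1, h2'⟩
  -- the epigraph is unbounded upwards
  by_contra! hs
  obtain ⟨x, hx⟩ := hf.exists_ne_top
  set r := (f x).toReal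
  have hr : f x = r := (EReal.coe_toReal hx (hf.ne_bot x)).symm
  set t := max r ((u - B x y) / φ (0, 1))
  have h3 := h2' x t (by rw [hr]; exact_mod_cast le_max_left _ _)
  have h4 : (u - B x y) / φ (0, 1) ≤ t := le_max_right _ _
  rw [div_le_iff_of_neg hs] at h4
  linarith

/-- A lower semicontinuous proper convex function is the supremum of its continuous affine
minorants. A vertical separating hyperplane is tilted by means of a minorant that exists because of
a point where the function is finite. -/
theorem IsProperConvex.exists_affine_minorant (B : E →ₗ[ℝ] F →ₗ[ℝ] ℝ) {f : E → EReal}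
    (hf : IsProperConvex f) (hlsc : @LowerSemicontinuous _ _ (weakTopology B) _ f) {x₀ : E} {a : ℝ}
    (ha : (a : EReal) < f x₀) :
    ∃ (y : F) (c : ℝ), (∀ x, ((B x y - c : ℝ) : EReal) ≤ f x) ∧ a ≤ B x₀ y - c := by
  have hreal : ∀ x, f x ≠ ⊤ → f x = ((f x).toReal : EReal) := fun x hx =>
    (EReal.coe_toReal hx (hf.ne_bot x)).symm
  have hminor : ∀ (y : F) (c : ℝ), (∀ x (t : ℝ), f x = t → B x y - c ≤ t) →
      ∀ x, ((B x y - c : ℝ) : EReal) ≤ f x := by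
    intro y c h x
    by_cases hx : f x = ⊤
    · rw [hx]; exact le_top
    · rw [hreal x hx]
      exact_mod_cast h x _ (hreal x hx)
  have hpos : ∀ {x₁ : E} {b : ℝ} {y : F} {s u : ℝ}, 0 < s → B x₁ y + s * b < u →
      (∀ (x : E) (t : ℝ), f x ≤ (t : EReal) → u < B x y + s * t) →
      ∃ (y : F) (c : ℝ), (∀ x, ((B x y - c : ℝ) : EReal) ≤ f x) ∧ b ≤ B x₁ y - c := by
    intro x₁ b y s u hs h1 h2
    refine ⟨-(s⁻¹ • y), -(s⁻¹ * u), hminor _ _ fun x t hx => ?_, ?_⟩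
    · have h3 := h2 x t hx.le
      rw [map_neg, map_smul, smul_eq_mul]
      have h4 : s⁻¹ * u < s⁻¹ * (B x y + s * t) := mul_lt_mul_of_pos_left h3 (inv_pos.2 hs)
      rw [mul_add, inv_mul_cancel_left₀ hs.ne'] at h4
      linarith
    · rw [map_neg, map_smul, smul_eq_mul]
      have h4 : s⁻¹ * (B x₁ y + s * b) < s⁻¹ * u := mul_lt_mul_of_pos_left h1 (inv_pos.2 hs)
      rw [mul_add, inv_mul_cancel_left₀ hs.ne'] at h4
      linarith
  obtain ⟨y, s, u, hs, h1, h2⟩ := hf.exists_separating_epigraph B hlsc ha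
  rcases hs.lt_or_eq with hs | rfl
  · exact hpos hs h1 h2
  · obtain ⟨x₁, hx₁⟩ := hf.exists_ne_top
    have hb : (((f x₁).toReal - 1 : ℝ) : EReal) < f x₁ := by
      conv_rhs => rw [hreal x₁ hx₁]
      exact_mod_cast sub_one_lt _
    obtain ⟨y', s', u', hs', h1', h2'⟩ := hf.exists_separating_epigraph B hlsc hb
    have hs'' : 0 < s' := by
      have h3 := h2' x₁ _ (hreal x₁ hx₁).le
      by_contra! h
      have : s' = 0 := le_antisymm h hs'
      subst this
      linarith
    obtain ⟨z, c, hz, -⟩ := hpos hs'' h1' h2'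
    have hd : 0 < u - B x₀ y := by linarith
    obtain ⟨k, hk⟩ := exists_nat_ge ((a - (B x₀ z - c)) / (u - B x₀ y))
    rw [div_le_iff₀ hd] at hk
    refine ⟨z - (k : ℝ) • y, c - k * u, hminor _ _ fun x t hx => ?_, ?_⟩
    · have h3 := h2 x t hx.le
      have h4 : B x z - c ≤ t := by
        have := hz x
        rw [hx] at this
        exact_mod_cast this
      rw [map_sub, map_smul, smul_eq_mul]
      nlinarith [(Nat.cast_nonneg k : (0 : ℝ) ≤ k)]
    · rw [map_sub, map_smul, smul_eq_mul]
      linarith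

/-- **Fenchel–Moreau theorem** for a pairing. -/
theorem IsProperConvex.eq_biconjugate (B : E →ₗ[ℝ] F →ₗ[ℝ] ℝ) {f : E → EReal}
    (hf : IsProperConvex f) (hlsc : @LowerSemicontinuous _ _ (weakTopology B) _ f) (x : E) :
    f x = ⨆ y : F, (((B x y : ℝ) : EReal) - conjugateFun B f y) := by
  refine le_antisymm (EReal.ge_of_forall_gt_iff_ge.1 fun a ha => ?_) (iSup_le fun y => ?_)
  · obtain ⟨y, c, h1, h2⟩ := hf.exists_affine_minorant B hlsc ha
    refine le_trans ?_ (le_iSup _ y)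
    have hconj : conjugateFun B f y ≤ (c : EReal) := by
      refine iSup_le fun z => ?_
      refine (EReal.sub_le_sub le_rfl (h1 z)).trans_eq ?_
      rw [← EReal.coe_sub]
      congr 1
      ring
    refine le_trans ?_ (EReal.sub_le_sub le_rfl hconj)
    rw [← EReal.coe_sub]
    exact_mod_cast h2
  · by_cases hx : f x = ⊤
    · rw [hx]; exact le_top
    · have hr : f x = ((f x).toReal : EReal) := (EReal.coe_toReal hx (hf.ne_bot x)).symm
      have h1 : ((B x y - (f x).toReal : ℝ) : EReal) ≤ conjugateFun B f y := by
        rw [EReal.coe_sub, ← hr]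
        exact le_iSup (fun z => ((B z y : ℝ) : EReal) - f z) x
      refine (EReal.sub_le_sub le_rfl h1).trans_eq ?_
      rw [← EReal.coe_sub, sub_sub_cancel, ← hr]

theorem lowerSemicontinuous_iSup_sub (B : E →ₗ[ℝ] F →ₗ[ℝ] ℝ) (g : F → EReal) :
    @LowerSemicontinuous _ _ (weakTopology B) _
      (fun x => ⨆ y : F, (((B x y : ℝ) : EReal) - g y)) := by
  let _ : TopologicalSpace E := weakTopology B
  refine lowerSemicontinuous_iSup fun y => ?_
  have hc : Continuous fun x => B x y := WeakBilin.eval_continuous B y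
  induction g y with
  | bot => simpa using lowerSemicontinuous_const
  | top => simpa using lowerSemicontinuous_const
  | coe r =>
    simp_rw [← EReal.coe_sub]
    exact (continuous_coe_real_ereal.comp (hc.sub continuous_const)).lowerSemicontinuous

theorem tendsto_weakTopology_iff (B : E →ₗ[ℝ] F →ₗ[ℝ] ℝ) {u : ℕ → E} {x : E} :
    Tendsto u atTop (@nhds _ (weakTopology B) x) ↔
      ∀ y, Tendsto (fun n => B (u n) y) atTop (𝓝 (B x y)) := by
  rw [show weakTopology B =
      TopologicalSpace.induced (fun x y => B x y) Pi.topologicalSpace from rfl,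
    nhds_induced, tendsto_comap_iff, tendsto_pi_nhds]
  rfl

/-- Mackey convergence implies weak convergence, because the segment `[-y, y]` is compact. -/
theorem tendsto_weakTopology_of_mackeyTopology (B : E →ₗ[ℝ] F →ₗ[ℝ] ℝ) {u : ℕ → E} {x : E}
    (h : Tendsto u atTop (@nhds _ (mackeyTopology B) x)) :
    Tendsto u atTop (@nhds _ (weakTopology B) x) := by
  rw [nhds_induced, tendsto_comap_iff, UniformOnFun.tendsto_iff_tendstoUniformlyOn] at h
  refine (tendsto_weakTopology_iff B).2 fun y => ?_
  have hA : (fun t : ℝ => t • y) '' Icc (-1) 1 ∈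
      {A : Set F | Convex ℝ A ∧ Balanced ℝ A ∧ @IsCompact F (weakTopology B.flip) A} := by
    refine ⟨?_, ?_, ?_⟩
    · exact (convex_Icc (-1 : ℝ) 1).is_linear_image
        ⟨fun s t => add_smul s t y, fun c t => by simp [mul_smul]⟩
    · rintro a ha _ ⟨_, ⟨t, ht, rfl⟩, rfl⟩
      refine ⟨a * t, ?_, by simp [mul_smul]⟩
      rw [mem_Icc, ← abs_le] at ht ⊢
      rw [abs_mul]
      exact mul_le_one₀ ha (abs_nonneg _) ht
    · let _ : TopologicalSpace F := weakTopology B.flip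
      refine isCompact_Icc.image ?_
      refine continuous_induced_rng.2 (continuous_pi fun z => ?_)
      have : (fun t : ℝ => B.flip (t • y) z) = fun t => t * B z y := by
        ext t; simp
      exact this ▸ continuous_mul_const _
  exact (h _ hA).tendsto_at ⟨1, by simp, one_smul _ _⟩

end DualPair

theorem LowerSemicontinuousWithinAt.le_liminf_of_tendsto {X : Type*} [TopologicalSpace X]
    {f : X → EReal} {s : Set X} {x : X} (hf : LowerSemicontinuousWithinAt f s x) {u : ℕ → X}
    (hu : Tendsto u atTop (𝓝[s] x)) : f x ≤ liminf (fun n => f (u n)) atTop :=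
  le_of_forall_lt_imp_le_of_dense fun a ha =>
    le_liminf_of_le (h := (hu.eventually (hf a ha)).mono fun _ h => h.le)

section OrderLsc

variable {Ω : Type*} [MeasurableSpace Ω] {P : Measure Ω} [IsProbabilityMeasure P]
  {Φ : YoungFunction}

/-- Dominated almost surely convergent sequences converge in probability. -/
theorem tendsto_l0Topology {L : Submodule ℝ (Ω →ₘ[P] ℝ)} {ξ : L} {u : ℕ → L}
    (h : ∀ᵐ ω ∂P, Tendsto (fun n => (u n : Ω →ₘ[P] ℝ) ω) atTop (𝓝 ((ξ : Ω →ₘ[P] ℝ) ω))) :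
    Tendsto u atTop (@nhds _ (l0Topology P L) ξ) := by
  let _ := l0PseudoMetric P
  rw [nhds_induced, tendsto_comap_iff, tendsto_iff_dist_tendsto_zero]
  change Tendsto (fun n => ∫ ω, min |(u n : Ω →ₘ[P] ℝ) ω - (ξ : Ω →ₘ[P] ℝ) ω| 1 ∂P) atTop (𝓝 0)
  rw [← integral_zero Ω ℝ (μ := P)]
  refine tendsto_integral_of_dominated_convergence (fun _ => 1)
    (fun n => (integrable_min_abs_sub P _ _).aestronglyMeasurable) (integrable_const _)
    (fun n => Eventually.of_forall fun ω => ?_) ?_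
  · rw [Real.norm_eq_abs, abs_of_nonneg (le_min (abs_nonneg _) zero_le_one)]
    exact min_le_right _ _
  · filter_upwards [h] with ω hω
    have h1 := (hω.sub_const ((ξ : Ω →ₘ[P] ℝ) ω)).abs
    rw [sub_self, abs_zero] at h1
    simpa using h1.min (tendsto_const_nhds (x := (1 : ℝ)))

/-- A sequence that converges fast in probability converges almost surely. -/
theorem ae_tendsto_of_integral_min_abs_sub_le {ξ : Ω →ₘ[P] ℝ} {u : ℕ → Ω →ₘ[P] ℝ}
    (h : ∀ n, ∫ ω, min |u n ω - ξ ω| 1 ∂P ≤ 2⁻¹ ^ n) :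
    ∀ᵐ ω ∂P, Tendsto (fun n => u n ω) atTop (𝓝 (ξ ω)) := by
  have hsum : Summable fun n : ℕ => (2⁻¹ : ℝ) ^ n :=
    summable_geometric_of_lt_one (by norm_num) (by norm_num)
  have h0 : ∀ n ω, 0 ≤ min |u n ω - ξ ω| 1 := fun n ω => le_min (abs_nonneg _) zero_le_one
  have hm : ∀ n, AEMeasurable (fun ω => ENNReal.ofReal (min |u n ω - ξ ω| 1)) P := fun n =>
    (integrable_min_abs_sub P (u n) ξ).aemeasurable.ennreal_ofReal
  have hfin : ∫⁻ ω, ∑' n, ENNReal.ofReal (min |u n ω - ξ ω| 1) ∂P ≠ ∞ := by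
    rw [lintegral_tsum hm]
    refine ne_top_of_le_ne_top (ENNReal.ofReal_ne_top (r := ∑' n : ℕ, (2⁻¹ : ℝ) ^ n)) ?_
    rw [ENNReal.ofReal_tsum_of_nonneg (fun n => by positivity) hsum]
    refine ENNReal.tsum_le_tsum fun n => ?_
    rw [← ofReal_integral_eq_lintegral_ofReal (integrable_min_abs_sub P (u n) ξ)
      (Eventually.of_forall (h0 n))]
    exact ENNReal.ofReal_le_ofReal (h n)
  filter_upwards [ae_lt_top' (AEMeasurable.tsum hm) hfin] with ω hω
  have h1 : Tendsto (fun n => min |u n ω - ξ ω| 1) atTop (𝓝 0) := by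
    have := (ENNReal.summable_toReal hω.ne).tendsto_atTop_zero
    simpa only [ENNReal.toReal_ofReal (h0 _ ω)] using this
  rw [tendsto_iff_dist_tendsto_zero]
  refine h1.congr' ?_
  filter_upwards [h1.eventually_lt_const one_pos] with n hn
  rw [Real.dist_eq]
  rcases min_lt_iff.1 hn with h2 | h2
  · exact min_eq_left h2.le
  · exact absurd h2 (lt_irrefl _)

/-- An order lower semicontinuous function is lower semicontinuous on order intervals for
convergence in probability, which is metrizable and implies almost sure convergence along a
subsequence. -/
theorem lowerSemicontinuousOn_l0Topology {L : Submodule ℝ (Ω →ₘ[P] ℝ)} {f : L → EReal} {S : Set L}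
    (h : ∀ (ξ : L) (u : ℕ → L), (∀ n, u n ∈ S) →
      (∀ᵐ ω ∂P, Tendsto (fun n => (u n : Ω →ₘ[P] ℝ) ω) atTop (𝓝 ((ξ : Ω →ₘ[P] ℝ) ω))) →
      f ξ ≤ liminf (fun n => f (u n)) atTop) :
    @LowerSemicontinuousOn _ _ (l0Topology P L) _ f S := by
  let _ := l0PseudoMetric P
  let _ : TopologicalSpace L := l0Topology P L
  intro ξ _ y hy
  by_contra hcon
  have hball : ∀ n : ℕ, {x : L | dist (x : Ω →ₘ[P] ℝ) ξ < 2⁻¹ ^ n} ∈ 𝓝 ξ := fun n => by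
    rw [nhds_induced]
    exact preimage_mem_comap (Metric.ball_mem_nhds _ (by positivity))
  have hex : ∀ n : ℕ, ∃ x : L, x ∈ S ∧ f x ≤ y ∧ dist (x : Ω →ₘ[P] ℝ) ξ < 2⁻¹ ^ n := fun n => by
    obtain ⟨x, hx, hx1, hx2⟩ := ((not_eventually.1 hcon).and_eventually
      (inter_mem self_mem_nhdsWithin (mem_nhdsWithin_of_mem_nhds (hball n)))).exists
    exact ⟨x, hx1, not_lt.1 hx, hx2⟩
  choose u hu hfu hd using hex
  have hlim := ae_tendsto_of_integral_min_abs_sub_le (P := P) (u := fun n => u n) (ξ := ξ)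
    fun n => (hd n).le
  have h1 := (h ξ u hu hlim).trans ((liminf_le_liminf (v := fun _ => y)
    (Eventually.of_forall hfu)).trans_eq (liminf_const y))
  exact absurd hy (not_lt.2 h1)

/-- Order closed convex sets are weakly closed. -/
theorem IsOrderClosed.isClosed_weakTopology (hΦ : Φ.Delta2) {C : Set (orliczSpace P Φ.conj)}
    (hC : Convex ℝ C) (hCo : IsOrderClosed C) :
    @IsClosed _ (weakTopology (orliczPairing P Φ)) C := by
  let _ : TopologicalSpace (orliczSpace P Φ.conj) := weakTopology (orliczPairing P Φ)
  rw [← isOpen_compl_iff, isOpen_iff_mem_nhds]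
  intro ξ₀ hξ₀
  have hco : IsOrderClosed ((fun ξ => ξ + ξ₀) ⁻¹' C) := by
    rintro ξ u hu hlim ⟨ζ, hζ, hdom⟩
    have habs : ∃ κ ∈ orliczSpace P Φ.conj, ∀ᵐ ω ∂P, |(ξ₀ : Ω →ₘ[P] ℝ) ω| ≤ κ ω := by
      obtain ⟨c, hc, hfin⟩ := ξ₀.2
      have hcoe := AEEqFun.coeFn_abs (ξ₀ : Ω →ₘ[P] ℝ)
      refine ⟨|(ξ₀ : Ω →ₘ[P] ℝ)|, ⟨c, hc, lt_of_le_of_lt (lintegral_mono_ae ?_) hfin⟩, ?_⟩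
      · filter_upwards [hcoe] with ω hω
        rw [hω]
        exact ENNReal.ofReal_le_ofReal (Φ.conj.mono_abs (by rw [abs_mul, abs_mul, abs_abs]))
      · filter_upwards [hcoe] with ω hω
        rw [hω]
    obtain ⟨κ, hκ, hκ'⟩ := habs
    refine hCo (ξ + ξ₀) (fun n => u n + ξ₀) hu ?_ ⟨ζ + κ, Submodule.add_mem _ hζ hκ, fun n => ?_⟩
    · filter_upwards [hlim, AEEqFun.coeFn_add (ξ : Ω →ₘ[P] ℝ) (ξ₀ : Ω →ₘ[P] ℝ),
        ae_all_iff.2 fun n => AEEqFun.coeFn_add (u n : Ω →ₘ[P] ℝ) (ξ₀ : Ω →ₘ[P] ℝ)] with ω h1 h2 h3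
      simp_rw [Submodule.coe_add, h2, h3, Pi.add_apply]
      exact h1.add_const _
    · filter_upwards [hdom n, hκ', AEEqFun.coeFn_add ζ κ,
        AEEqFun.coeFn_add (u n : Ω →ₘ[P] ℝ) (ξ₀ : Ω →ₘ[P] ℝ)] with ω h1 h2 h3 h4
      rw [Submodule.coe_add, h3, h4, Pi.add_apply, Pi.add_apply]
      exact (abs_add_le _ _).trans (add_le_add h1 h2)
  obtain ⟨η, c, hc, hη⟩ := hco.exists_separating hΦ (hC.translate_preimage_left ξ₀)
    (by simpa using hξ₀)
  have hcont : Continuous fun ξ => orliczPairing P Φ ξ η :=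
    WeakBilin.eval_continuous (orliczPairing P Φ) η
  filter_upwards [hcont.tendsto ξ₀ |>.eventually_lt_const
    (show orliczPairing P Φ ξ₀ η < orliczPairing P Φ ξ₀ η + c by linarith)] with ξ hξ hξC
  have h1 := hη (ξ - ξ₀) (by simpa using hξC)
  rw [map_sub, LinearMap.sub_apply] at h1
  linarith

end OrderLsc

theorem theorem4p4 {Ω : Type*} [MeasurableSpace Ω] (P : Measure Ω) [IsProbabilityMeasure P]
    (Φ : YoungFunction) (hΦ : Φ.Delta2)
    (f : orliczSpace P Φ.conj → EReal) (hf : IsProperConvex f) :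
    List.TFAE [
      -- `f` is `σ(L_{Φ*}, L_Φ)`-lsc
      @LowerSemicontinuous _ _ (weakTopology (orliczPairing P Φ)) _ f,
      -- dual representation over `L_Φ`
      ∀ ξ, f ξ = ⨆ η : orliczSpace P Φ,
        (((orliczPairing P Φ ξ η : ℝ) : EReal) - conjugateFun (orliczPairing P Φ) f η),
      -- `f` is sequentially `τ(L_{Φ*}, L_Φ)`-lsc
      ∀ (ξ : orliczSpace P Φ.conj) (u : ℕ → orliczSpace P Φ.conj),
        Tendsto u atTop (@nhds _ (mackeyTopology (orliczPairing P Φ)) ξ) →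
          f ξ ≤ liminf (fun n => f (u n)) atTop,
      -- `f` is `τ_{L₀}`-lsc on every order interval `[-ζ, ζ]` of `L_{Φ*}`
      ∀ ζ : orliczSpace P Φ.conj, 0 ≤ (ζ : Ω →ₘ[P] ℝ) →
        @LowerSemicontinuousOn _ _ (l0Topology P (orliczSpace P Φ.conj)) _ f
          {ξ | (ξ : Ω →ₘ[P] ℝ) ∈ Icc (-(ζ : Ω →ₘ[P] ℝ)) ζ},
      -- `f` is order lsc
      ∀ (ξ : orliczSpace P Φ.conj) (u : ℕ → orliczSpace P Φ.conj),
        (∀ᵐ ω ∂P, Tendsto (fun n => (u n : Ω →ₘ[P] ℝ) ω) atTop (𝓝 ((ξ : Ω →ₘ[P] ℝ) ω))) →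
        (∃ ζ : orliczSpace P Φ.conj, ∀ n,
          (u n : Ω →ₘ[P] ℝ) ∈ Icc (-(ζ : Ω →ₘ[P] ℝ)) ζ) →
          f ξ ≤ liminf (fun n => f (u n)) atTop] := by
  tfae_have 1 → 2 := fun h ξ => hf.eq_biconjugate _ h ξ
  tfae_have 2 → 1 := fun h => by
    have : f = fun ξ => ⨆ η : orliczSpace P Φ,
      (((orliczPairing P Φ ξ η : ℝ) : EReal) - conjugateFun (orliczPairing P Φ) f η) := funext h
    rw [this]
    exact lowerSemicontinuous_iSup_sub _ _
  tfae_have 1 → 3 := fun h ξ u hu => by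
    let _ : TopologicalSpace (orliczSpace P Φ.conj) := weakTopology (orliczPairing P Φ)
    refine LowerSemicontinuousWithinAt.le_liminf_of_tendsto (s := univ) (fun y hy => ?_) ?_
    · rw [nhdsWithin_univ]
      exact h ξ y hy
    rw [nhdsWithin_univ]
    exact tendsto_weakTopology_of_mackeyTopology _ hu
  tfae_have 3 → 5 := by
    rintro h ξ u hlim ⟨ζ, hζ⟩
    exact h ξ u (tendsto_mackeyTopology ζ.2 (fun n => mem_Icc_neg_iff.1 (hζ n)) hlim)
  tfae_have 5 → 4 := fun h ζ _ =>
    lowerSemicontinuousOn_l0Topology fun ξ u hu hlim => h ξ u hlim ⟨ζ, hu⟩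
  tfae_have 4 → 5 := by
    rintro h ξ u hlim ⟨ζ, hζ⟩
    have hζ' : ∀ᵐ ω ∂P, ∀ n, |(u n : Ω →ₘ[P] ℝ) ω| ≤ (ζ : Ω →ₘ[P] ℝ) ω :=
      ae_all_iff.2 fun n => mem_Icc_neg_iff.1 (hζ n)
    have h0 : 0 ≤ (ζ : Ω →ₘ[P] ℝ) := by
      rw [← AEEqFun.coeFn_le]
      filter_upwards [hζ', AEEqFun.coeFn_zero (α := Ω) (β := ℝ) (μ := P)] with ω h1 h2
      rw [h2]
      exact (abs_nonneg _).trans (h1 0)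
    have hξ : (ξ : Ω →ₘ[P] ℝ) ∈ Icc (-(ζ : Ω →ₘ[P] ℝ)) ζ := by
      rw [mem_Icc_neg_iff]
      filter_upwards [hζ', hlim] with ω h1 h2
      exact le_of_tendsto h2.abs (Eventually.of_forall h1)
    let _ : TopologicalSpace (orliczSpace P Φ.conj) := l0Topology P (orliczSpace P Φ.conj)
    exact LowerSemicontinuousWithinAt.le_liminf_of_tendsto (h ζ h0 ξ hξ) (tendsto_nhdsWithin_iff.2
      ⟨tendsto_l0Topology hlim, Eventually.of_forall hζ⟩)
  tfae_have 5 → 1 := by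
    intro h
    let _ : TopologicalSpace (orliczSpace P Φ.conj) := weakTopology (orliczPairing P Φ)
    refine lowerSemicontinuous_iff_isClosed_preimage.2 fun y => ?_
    induction y with
    | bot =>
      have : f ⁻¹' Iic ⊥ = ∅ := by
        ext ξ; simp [hf.ne_bot ξ]
      rw [this]
      exact isClosed_empty
    | top => simp
    | coe c =>
      refine IsOrderClosed.isClosed_weakTopology hΦ (hf.convex_sublevel c) ?_
      rintro ξ u hu hlim ⟨ζ, hζ, hdom⟩
      exact (h ξ u hlim ⟨⟨ζ, hζ⟩, fun n => mem_Icc_neg_iff.2 (hdom n)⟩).trans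
        ((liminf_le_liminf (v := fun _ => (c : EReal))
          (Eventually.of_forall hu)).trans_eq (liminf_const _))
  tfae_finish
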